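/- Let $\mathbb{K}$ be an algebraically closed field of characteristic $0$, $E$ an $n$-dimensional $\mathbb{K}$-vector space with a fixed basis $e_1,\dots,e_n$, and $\mathcal{V}_n$ the vector space of skew-symmetric bilinear maps $\mu:E\times E\to E$, regarded as an affine space with the structure constants $X_{ij}^k$ ($i<j$), $\mu(e_i,e_j)=\sum_k X_{ij}^k e_k$, as coordinates, and with its Zariski topology. The group $GL(E)$ acts on $\mathcal{V}_n$ by $\mu_f(X,Y)=f^{-1}(\mu(f(X),f(Y)))$; let $\mathcal{O}(\mu)=\{\mu_f : f\in GL(E)\}$ be the orbit of $\mu$. For $f\in gl(E)$ put $\delta f(X,Y)=\mu(f(X),Y)+\mu(X,f(Y))-f(\mu(X,Y))$ and let $B^2(\mu,\mu)=\{\delta f : f\in gl(E)\}\subset\mathcal{V}_n$. For a Zariski-locally closed subset $S\subset\mathcal{V}_n$ and $\mu\in S$, let $T_\mu S\subset\mathcal{V}_n$ denote the tangent space of $S$ (as a reduced variety) at $\mu$, that is, the set of all $\varphi\in\mathcal{V}_n$ with $(dp)_\mu(\varphi)=0$ for every polynomial $p$ on $\mathcal{V}_n$ that vanishes on $S$. Let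 $\mathcal{W}$ be an algebraic subset of $\mathcal{V}_n$ (not necessarily irreducible), stable under the action of $GL(E)$, and let $\mu\in\mathcal{W}$. Then $T_\mu\mathcal{O}(\mu)=B^2(\mu,\mu)$. Moreover, if $$\dim T_\mu\mathcal{O}(\mu)=\dim B^2(\mu,\mu)=\dim T_\mu\mathcal{W},$$ then $\mu$ is $\mathcal{W}$-rigid, i.e. the orbit $\mathcal{O}(\mu)$ is open in $\mathcal{W}$. -/

import Mathlib

namespace RigidMul

open MvPolynomial

section Basic

variable {K : Type*} [Field K] {E : Type*} [AddCommGroup E] [Module K E]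

variable (K E) in
/-- The space of skew-symmetric (alternating) `K`-bilinear maps `E × E → E`. -/
def SBil : Submodule K (E →ₗ[K] E →ₗ[K] E) where
  carrier := {μ | ∀ x, μ x x = 0}
  zero_mem' _ := rfl
  add_mem' {μ ν} hμ hν x := by
    have h1 := hμ x
    have h2 := hν x
    simp [h1, h2]
  smul_mem' c μ hμ x := by
    have h1 := hμ x
    simp [h1]

theorem SBil_self (μ : SBil K E) (x : E) : μ.1 x x = 0 := μ.2 x

theorem SBil_skew (μ : SBil K E) (x y : E) : μ.1 x y + μ.1 y x = 0 := by
  have h := SBil_self μ (x + y)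
  simpa [SBil_self μ x, SBil_self μ y, add_comm] using h

/-- The action of the general linear group: `μ_f (X, Y) = f⁻¹ (μ (f X, f Y))`. -/
def act (f : E ≃ₗ[K] E) (μ : SBil K E) : SBil K E :=
  ⟨LinearMap.mk₂ K (fun x y => f.symm (μ.1 (f x) (f y)))
      (by intros; simp) (by intros; simp) (by intros; simp) (by intros; simp),
    fun x => by simp [SBil_self μ]⟩

/-- The orbit `O(μ) = {μ_f : f ∈ GL(E)}`. -/
def orbit (μ : SBil K E) : Set (SBil K E) := Set.range fun f : E ≃ₗ[K] E => act f μ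

/-- Stability of a set of multiplications under the action of `GL(E)`. -/
def IsStable (W : Set (SBil K E)) : Prop := ∀ μ ∈ W, ∀ f : E ≃ₗ[K] E, act f μ ∈ W

/-- The coboundary operator `(δ f)(X, Y) = μ(f X, Y) + μ(X, f Y) - f (μ(X, Y))`. -/
def coboundary (μ : SBil K E) : (E →ₗ[K] E) →ₗ[K] SBil K E where
  toFun f :=
    ⟨LinearMap.mk₂ K (fun x y => μ.1 (f x) y + μ.1 x (f y) - f (μ.1 x y))
        (by intros; simp; abel) (by intros; simp [smul_add, smul_sub])
        (by intros; simp; abel) (by intros; simp [smul_add, smul_sub]),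
      fun x => by simp [SBil_self μ, SBil_skew μ]⟩
  map_add' f g := by
    ext x y
    simp
    abel
  map_smul' c f := by
    ext x y
    simp [smul_add, smul_sub]

/-- The space of coboundaries `B²(μ, μ) = {δ f : f ∈ gl(E)}`. -/
def B2 (μ : SBil K E) : Submodule K (SBil K E) := LinearMap.range (coboundary μ)

/-- Indices `(i, j, k)` with `i < j` of the independent structure constants. -/
abbrev Idx (n : ℕ) : Type := {t : Fin n × Fin n × Fin n // t.1 < t.2.1}

variable {n : ℕ} (b : Module.Basis (Fin n) K E)

/-- The structure constants `X_{ij}^k`, `i < j`, with `μ(e_i, e_j) = ∑ k, X_{ij}^k e_k`; they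
identify the space of skew-symmetric bilinear maps with an affine space. -/
noncomputable def structConst : SBil K E →ₗ[K] (Idx n → K) where
  toFun μ t := b.repr (μ.1 (b t.1.1) (b t.1.2.1)) t.1.2.2
  map_add' μ ν := by
    ext t
    simp
  map_smul' c μ := by
    ext t
    simp

/-- Algebraic subsets: sets of common zeros of a system of polynomials in the structure constants
(by Hilbert's basis theorem the system may be taken finite). -/
def IsAlgebraicSubset (Z : Set (SBil K E)) : Prop :=
  ∃ P : Set (MvPolynomial (Idx n) K), ∀ μ, μ ∈ Z ↔ ∀ p ∈ P, eval (structConst b μ) p = 0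

theorem isAlgebraicSubset_empty : IsAlgebraicSubset b (∅ : Set (SBil K E)) :=
  ⟨{1}, fun μ => by simp⟩

theorem isAlgebraicSubset_sInter (A : Set (Set (SBil K E)))
    (hA : ∀ Z ∈ A, IsAlgebraicSubset b Z) : IsAlgebraicSubset b (⋂₀ A) := by
  choose P hP using fun Z : A => hA Z.1 Z.2
  refine ⟨⋃ Z, P Z, fun μ => ?_⟩
  simp only [Set.mem_sInter, Set.mem_iUnion]
  constructor
  · rintro h p ⟨Z, hp⟩
    exact (hP Z μ).1 (h Z.1 Z.2) p hp
  · intro h Z hZ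
    exact (hP ⟨Z, hZ⟩ μ).2 fun p hp => h p ⟨⟨Z, hZ⟩, hp⟩

theorem isAlgebraicSubset_union (Y Z : Set (SBil K E)) (hY : IsAlgebraicSubset b Y)
    (hZ : IsAlgebraicSubset b Z) : IsAlgebraicSubset b (Y ∪ Z) := by
  obtain ⟨P, hP⟩ := hY
  obtain ⟨Q, hQ⟩ := hZ
  refine ⟨{r | ∃ p ∈ P, ∃ q ∈ Q, r = p * q}, fun μ => ?_⟩
  rw [Set.mem_union, hP, hQ]
  constructor
  · rintro (h | h) r ⟨p, hp, q, hq, rfl⟩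
    · rw [map_mul, h p hp, zero_mul]
    · rw [map_mul, h q hq, mul_zero]
  · intro h
    by_contra! hc
    obtain ⟨⟨p, hp, hp0⟩, q, hq, hq0⟩ := hc
    have h1 := h (p * q) ⟨p, hp, q, hq, rfl⟩
    rw [map_mul] at h1
    exact (mul_ne_zero hp0 hq0) h1

/-- The Zariski topology on the space of skew-symmetric bilinear maps: the closed sets are the
algebraic subsets. -/
@[reducible]
def zariski : TopologicalSpace (SBil K E) :=
  TopologicalSpace.ofClosed {Z | IsAlgebraicSubset b Z} (isAlgebraicSubset_empty b)
    (fun A hA => isAlgebraicSubset_sInter b A hA)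
    (fun Y hY Z hZ => isAlgebraicSubset_union b Y Z hY hZ)

/-- `μ` is `W`-rigid: it lies in `W` and its orbit is an open subset of `W`, where `W` carries the
topology induced by the Zariski topology. -/
def IsRigidIn (W : Set (SBil K E)) (μ : SBil K E) : Prop :=
  μ ∈ W ∧ ∃ U : Set (SBil K E), @IsOpen _ (zariski b) U ∧ orbit μ = W ∩ U

/-- The tangent space at `μ` of the reduced variety carried by a (locally closed) set `S`: the
vectors `φ` such that `(d p)_μ (φ) = 0` for every polynomial `p` in the structure constants that
vanishes on `S`. -/
noncomputable def tangentSpace (S : Set (SBil K E)) (μ : SBil K E) : Submodule K (SBil K E) where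
  carrier := {φ | ∀ p ∈ vanishingIdeal K (structConst b '' S),
    ∑ t, eval (structConst b μ) (pderiv t p) * structConst b φ t = 0}
  zero_mem' p _ := by simp
  add_mem' {φ ψ} hφ hψ p hp := by
    have h1 := hφ p hp
    have h2 := hψ p hp
    simp only [map_add, Pi.add_apply, mul_add, Finset.sum_add_distrib, h1, h2, add_zero]
  smul_mem' c φ hφ p hp := by
    have h1 := hφ p hp
    simp only [map_smul, Pi.smul_apply, smul_eq_mul, mul_left_comm _ c, ← Finset.mul_sum, h1,
      mul_zero]

end Basic

end RigidMul

/-! The inclusion `B² ⊆ T_μ O(μ)` comes from the point `1 + εa` of `GL` over the dual numbers. It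
carries `μ` to `μ + ε δa`, and a polynomial vanishing on the orbit vanishes at every point of the
orbit with values in a `K`-algebra (`mem_vanishingIdeal_orbit_iff`).

For the converse, let `M` be the function field of `GL`, `X` the generic matrix, and `φ` tangent to
the orbit at `μ`. By equivariance the translate `φ_X` is tangent at the generic point `μ_X`, so `μ_X
↦ μ_X + ε φ_X` defines a derivation on the subfield of `M` generated by the coordinates of `μ_X`. In
characteristic zero it extends to a derivation `D` of `M` (`exists_dualNumber_extension`). Writing
`D X = (1 + εa) X`, the image of `μ_X` is also `(μ + ε δa)_X`; cancelling `X` gives `φ = δa` over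
`M` (`exists_infTransport_eq`), and a `K`-linear retraction `M → K` brings `a` down to `K`.

For rigidity, the orbit lies in `W`, so equal dimensions force `T_μ W = B²`. Let `γ` be a projection
of the coordinate space with kernel `B²`. By an algebraic implicit function theorem every `ω` near
`μ` is moved by some `1 + αx` into the slice `μ + γx` (`exists_sliceRel_eq_zero`). The components of
`γ` vanish on `T_μ W`, hence are differentials at `μ` of polynomials vanishing on `W`. Restricted to
the slice, these form a system whose only zero near `μ` is `γx = 0`; so every `ω ∈ W` near `μ` lies
in the orbit (`exists_basicOpen_inter_subset_orbit`). Translating this neighbourhood by `GL` gives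
openness. -/

namespace RigidMul

open MvPolynomial

/-! ### Dual numbers and extension of derivations -/

section DualNumbers

/-- Taylor expansion to first order of a polynomial over the dual numbers. -/
theorem eval₂_dualNumber {σ R S : Type*} [Fintype σ] [CommRing R] [CommRing S] (f : R →+* S)
    (x v : σ → S) (p : MvPolynomial σ R) :
    eval₂ ((TrivSqZeroExt.inlHom S S).comp f)
        (fun s => (TrivSqZeroExt.inl (x s) + TrivSqZeroExt.inr (v s) : DualNumber S)) p =
      TrivSqZeroExt.inl (eval₂ f x p) +
        TrivSqZeroExt.inr (∑ s, eval₂ f x (pderiv s p) * v s) := by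
  classical
  induction p using MvPolynomial.induction_on with
  | C a => ext <;> simp
  | add p q hp hq =>
    rw [eval₂_add, hp, hq]
    ext <;> simp [eval₂_add, add_mul, Finset.sum_add_distrib]
  | mul_X p i hp =>
    rw [eval₂_mul, hp, eval₂_X]
    ext
    · simp
    · simp [pderiv_X, eval₂_add, eval₂_mul, add_mul, Finset.sum_add_distrib,
        Pi.single_apply, apply_ite (eval₂ f x), Finset.sum_mul]
      exact Finset.sum_congr rfl fun s _ => by ring

/-- Stated for arbitrary algebra structures, since it is applied to the dual numbers with a
structure twisted by a derivation. -/
theorem exists_section_of_formallySmooth {L M B : Type*} [CommRing L] [CommRing M] [CommRing B]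
    [Algebra L M] [Algebra L B] [Algebra.FormallySmooth L M] (q : B →ₐ[L] M)
    (hq : Function.Surjective q) (hnil : IsNilpotent (RingHom.ker (q : B →+* M))) :
    ∃ D : M →ₐ[L] B, ∀ x, q (D x) = x :=
  ⟨Algebra.FormallySmooth.liftOfSurjective (AlgHom.id L M) q hq hnil, fun x =>
    Algebra.FormallySmooth.liftOfSurjective_apply _ _ _ _ x⟩

theorem isNilpotent_ker_fst (M : Type*) [CommRing M] (q : DualNumber M →+* M)
    (hq : ∀ z, q z = z.fst) : IsNilpotent (RingHom.ker q) := by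
  refine ⟨2, ?_⟩
  rw [Ideal.zero_eq_bot, eq_bot_iff, show RingHom.ker q ^ 2 = RingHom.ker q * RingHom.ker q from
    pow_two _, Ideal.mul_le]
  intro a ha b hb
  rw [RingHom.mem_ker, hq] at ha hb
  rw [Ideal.mem_bot]
  ext <;> simp [ha, hb]

/-- In characteristic zero, a derivation into a finitely generated field extension extends to that
extension; derivations are written as homomorphisms to the dual numbers. -/
theorem exists_dualNumber_extension {K R M : Type*} [Field K] [CharZero K] [CommRing R] [Field M]
    [Algebra K R] [Algebra K M] [Algebra.EssFiniteType K M] (ev : R →ₐ[K] M)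
    (F : R →ₐ[K] DualNumber M) (hfst : ∀ r, (F r).fst = ev r) (hker : ∀ r, ev r = 0 → F r = 0) :
    ∃ D : M →ₐ[K] DualNumber M, (∀ x, (D x).fst = x) ∧ ∀ r, D (ev r) = F r := by
  have hP : (RingHom.ker ev).IsPrime := RingHom.ker_isPrime _
  let P : Ideal R := RingHom.ker ev
  let j : P.ResidueField →ₐ[K] M := Ideal.ResidueField.liftₐ P ev le_rfl fun r hr =>
    isUnit_iff_ne_zero.2 hr
  -- A dual number is invertible once its first component is, so `F` extends to fractions with
  -- denominators outside `P`.
  let k : P.ResidueField →ₐ[K] DualNumber M := Ideal.ResidueField.liftₐ P F hker fun r hr => by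
    refine (TrivSqZeroExt.isUnit_iff_isUnit_fst).2 ?_
    change IsUnit (F r).fst
    rw [hfst]
    exact isUnit_iff_ne_zero.2 hr
  have hjk : ∀ l, (k l).fst = j l := by
    have : (TrivSqZeroExt.fstHom K M M).comp k = j := by
      refine AlgHom.coe_ringHom_injective (Ideal.ResidueField.ringHom_ext (RingHom.ext fun r => ?_))
      have h1 : k (algebraMap R _ r) = F r := Ideal.ResidueField.liftₐ_algebraMap ..
      have h2 : j (algebraMap R _ r) = ev r := Ideal.ResidueField.liftₐ_algebraMap ..
      change (k (algebraMap R _ r)).fst = j (algebraMap R _ r)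
      rw [h1, h2, hfst]
    exact fun l => DFunLike.congr_fun this l
  have hk : ∀ c, k (algebraMap K _ c) = algebraMap K _ c := k.commutes
  let : Algebra P.ResidueField M := j.toRingHom.toAlgebra
  have : IsScalarTower K P.ResidueField M :=
    IsScalarTower.of_algebraMap_eq fun c => (j.commutes c).symm
  have : Algebra.EssFiniteType P.ResidueField M := .of_comp K _ _
  have : CharZero P.ResidueField := charZero_of_injective_algebraMap (algebraMap K _).injective
  -- A finitely generated field extension in characteristic zero is separable, hence formally
  -- smooth.
  have hsm : Algebra.FormallySmooth P.ResidueField M := inferInstance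
  obtain ⟨D, hD1, hD2⟩ : ∃ D : M →+* DualNumber M, (∀ x, (D x).fst = x) ∧ ∀ l, D (j l) = k l := by
    -- The residue field acts on the dual numbers through `k`, so that algebra sections of `fst` are
    -- exactly the derivations extending the given one.
    let algB : Algebra P.ResidueField (DualNumber M) := k.toRingHom.toAlgebra
    let q : @AlgHom P.ResidueField (DualNumber M) M _ _ _ algB _ :=
      @AlgHom.mk _ _ _ _ _ _ algB _ (TrivSqZeroExt.fstHom K M M).toRingHom hjk
    obtain ⟨D, hD⟩ := @exists_section_of_formallySmooth P.ResidueField M (DualNumber M) _ _ _ _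
      algB hsm q (fun x => ⟨TrivSqZeroExt.inl x, by rfl⟩)
      (isNilpotent_ker_fst M _ fun z => rfl)
    exact ⟨D.toRingHom, hD, fun l => D.commutes l⟩
  refine ⟨{ D with commutes' := fun c => ?_ }, hD1, fun r => ?_⟩
  · have := hD2 (algebraMap K _ c)
    rw [hk, j.commutes] at this
    exact this
  · have := hD2 (algebraMap R _ r)
    rwa [show j (algebraMap R _ r) = ev r from Ideal.ResidueField.liftₐ_algebraMap ..,
      show k (algebraMap R _ r) = F r from Ideal.ResidueField.liftₐ_algebraMap ..] at this

end DualNumbers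

/-! ### Algebraic implicit function theorem -/

section ImplicitFunction

/-- By the Nullstellensatz, a nonempty fibre over a `K`-point contains a `K`-point: the residue
field at a maximal ideal of the fibre is of finite type over `K`, hence finite, hence embeds in `K`.
-/
theorem exists_algHom_of_mem_range_comap {K R B : Type*} [Field K] [IsAlgClosed K] [CommRing R]
    [CommRing B] [Algebra K R] [Algebra K B] [Algebra R B] [IsScalarTower K R B]
    [Algebra.FiniteType R B] (y : R →ₐ[K] K)
    (hy : ∃ q : PrimeSpectrum B, PrimeSpectrum.comap (algebraMap R B) q =
      ⟨RingHom.ker y, RingHom.ker_isPrime _⟩) :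
    ∃ z : B →ₐ[K] K, ∀ r, z (algebraMap R B r) = y r := by
  obtain ⟨q, hq⟩ := hy
  let N : Ideal B := (RingHom.ker y).map (algebraMap R B)
  have hqN : N ≤ q.asIdeal := by
    rw [Ideal.map_le_iff_le_comap]
    have := congrArg PrimeSpectrum.asIdeal hq
    exact this.ge
  obtain ⟨m, hm, hqm⟩ := Ideal.exists_le_maximal q.asIdeal q.2.ne_top
  have hsub : ∀ r, Ideal.Quotient.mk m (algebraMap R B r) =
      Ideal.Quotient.mk m (algebraMap K B (y r)) := fun r => by
    rw [Ideal.Quotient.eq, IsScalarTower.algebraMap_apply K R B, ← map_sub]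
    refine hqm (hqN (Ideal.mem_map_of_mem _ ?_))
    simp [RingHom.mem_ker]
  let := Ideal.Quotient.field m
  have hft : Algebra.FiniteType K (B ⧸ m) := by
    let : Algebra R K := y.toRingHom.toAlgebra
    obtain ⟨s, hs⟩ := (Algebra.FiniteType.out : (⊤ : Subalgebra R B).FG)
    classical
    refine ⟨⟨s.image (Ideal.Quotient.mk m), ?_⟩⟩
    rw [eq_top_iff]
    rintro x -
    obtain ⟨b, rfl⟩ := Ideal.Quotient.mk_surjective x
    have hb : b ∈ Algebra.adjoin R (s : Set B) := by rw [hs]; trivial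
    induction hb using Algebra.adjoin_induction with
    | mem x hx =>
      exact Algebra.subset_adjoin (by simpa using ⟨x, hx, rfl⟩)
    | algebraMap r =>
      rw [hsub]
      exact Subalgebra.algebraMap_mem _ (y r)
    | add a b _ _ ha hb => rw [map_add]; exact add_mem ha hb
    | mul a b _ _ ha hb => rw [map_mul]; exact mul_mem ha hb
  have hfin : Module.Finite K (B ⧸ m) := finite_of_finite_type_of_isJacobsonRing _ _
  let e : (B ⧸ m) →ₐ[K] K := IsAlgClosed.lift
  refine ⟨e.comp (Ideal.Quotient.mkₐ K m), fun r => ?_⟩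
  simp [hsub]

/-- The locus in a square system of equations where the Jacobian determinant and a further
polynomial are invertible is smooth over the ring of parameters. -/
theorem exists_smooth_of_jacobian.{u, v, w} {σ : Type u} {R : Type v} [CommRing R]
    [Fintype σ] [DecidableEq σ]
    (v : σ → MvPolynomial σ R) (h : MvPolynomial σ R) :
    ∃ (B : Type (max u v)) (_ : CommRing B) (_ : Algebra R B) (π : MvPolynomial σ R →ₐ[R] B),
      Algebra.Smooth R B ∧ (∀ s, π (v s) = 0) ∧ IsUnit (π h) ∧
      ∀ {T : Type w} [CommRing T] (f : MvPolynomial σ R →+* T), (∀ s, f (v s) = 0) →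
        IsUnit (f (Matrix.of fun i j => pderiv i (v j)).det) → IsUnit (f h) →
        ∃ z : B →+* T, ∀ p, z (π p) = f p := by
  let P : Algebra.PreSubmersivePresentation R
      (MvPolynomial σ R ⧸ Ideal.span (Set.range v)) σ σ :=
    Algebra.PreSubmersivePresentation.naive id Function.injective_id
  have hjacP : P.jacobian = Ideal.Quotient.mk (Ideal.span (Set.range v))
      (Matrix.of fun i j => pderiv i (v j)).det := by
    rw [Algebra.PreSubmersivePresentation.jacobian_eq_jacobiMatrix_det]
    change Ideal.Quotient.mk (Ideal.span (Set.range v)) P.jacobiMatrix.det = _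
    have hmat : P.jacobiMatrix = Matrix.of fun i j => pderiv i (v j) := by
      refine Matrix.ext fun i j => ?_
      exact Algebra.PreSubmersivePresentation.jacobiMatrix_apply P i j
    rw [hmat]
  let r := P.jacobian * Ideal.Quotient.mk (Ideal.span (Set.range v)) h
  let B := Localization.Away r
  have hr : IsUnit (algebraMap _ B r) := IsLocalization.Away.algebraMap_isUnit r
  rw [map_mul, IsUnit.mul_iff] at hr
  -- The Jacobian of the composite presentation is the product of the two Jacobians, and that of `P`
  -- has just been inverted.
  let Q := (Algebra.SubmersivePresentation.localizationAway B r).toPreSubmersivePresentation.comp P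
  let Q' : Algebra.SubmersivePresentation R B (Unit ⊕ σ) (Unit ⊕ σ) :=
    { Q with
      jacobian_isUnit := by
        change IsUnit Q.jacobian
        rw [Algebra.PreSubmersivePresentation.comp_jacobian_eq_jacobian_smul_jacobian,
          Algebra.smul_def, IsUnit.mul_iff]
        exact ⟨hr.1, Algebra.SubmersivePresentation.jacobian_isUnit _⟩ }
  have : Algebra.IsStandardSmooth R B := Q'.isStandardSmooth
  refine ⟨B, inferInstance, inferInstance,
    (IsScalarTower.toAlgHom R _ B).comp (Ideal.Quotient.mkₐ R (Ideal.span (Set.range v))),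
    inferInstance, fun s => ?_, hr.2, fun f hf hJ hh => ?_⟩
  · have : Ideal.Quotient.mk (Ideal.span (Set.range v)) (v s) = 0 :=
      Ideal.Quotient.eq_zero_iff_mem.2 (Ideal.subset_span ⟨s, rfl⟩)
    simp [this]
  · have hle : Ideal.span (Set.range v) ≤ RingHom.ker f := by
      rw [Ideal.span_le]
      intro a ha
      obtain ⟨s, rfl⟩ := ha
      exact hf s
    let z₀ := Ideal.Quotient.lift (Ideal.span (Set.range v)) f fun a ha => hle ha
    have hz₀ : IsUnit (z₀ r) := by
      rw [map_mul, hjacP]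
      exact hJ.mul hh
    exact ⟨IsLocalization.Away.lift r hz₀, fun p => IsLocalization.Away.lift_eq r hz₀ _⟩

/-- The algebraic implicit function theorem: where the Jacobian determinant of a square system
of equations does not vanish, the system can be solved over a Zariski neighbourhood of the
parameter, with the solution in a prescribed open set. -/
theorem exists_basicOpen_solution {K σ τ : Type*} [Field K] [IsAlgClosed K] [Fintype σ]
    [DecidableEq σ] (v : σ → MvPolynomial σ (MvPolynomial τ K))
    (h : MvPolynomial σ (MvPolynomial τ K)) (x₀ : σ → K) (y₀ : τ → K)
    (hv : ∀ s, eval₂ (eval y₀) x₀ (v s) = 0)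
    (hjac : (Matrix.of fun i j => eval₂ (eval y₀) x₀ (pderiv i (v j))).det ≠ 0)
    (hh : eval₂ (eval y₀) x₀ h ≠ 0) :
    ∃ g : MvPolynomial τ K, eval y₀ g ≠ 0 ∧ ∀ y, eval y g ≠ 0 →
      ∃ x : σ → K, (∀ s, eval₂ (eval y) x (v s) = 0) ∧ eval₂ (eval y) x h ≠ 0 := by
  obtain ⟨B, _, _, π, hsm, hπv, hπh, hlift⟩ := exists_smooth_of_jacobian v h
  -- Smooth maps are flat and finitely presented, hence open on spectra; so the image contains a
  -- basic neighbourhood of `y₀`.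
  have hopen : IsOpenMap (PrimeSpectrum.comap (algebraMap (MvPolynomial τ K) B)) :=
    PrimeSpectrum.isOpenMap_comap_of_hasGoingDown_of_finitePresentation
  obtain ⟨z₁, hz₁⟩ := hlift (eval₂Hom (eval y₀) x₀) hv
    (by rw [RingHom.map_det]; exact isUnit_iff_ne_zero.2 hjac) (isUnit_iff_ne_zero.2 hh)
  have hz₁' : ∀ a, z₁ (algebraMap _ B a) = eval y₀ a := fun a => by
    rw [← π.commutes, hz₁]
    exact eval₂_C _ _ _
  obtain ⟨g, hg1, hg2⟩ : ∃ g, eval y₀ g ≠ 0 ∧ (PrimeSpectrum.basicOpen g : Set _) ⊆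
      Set.range (PrimeSpectrum.comap (algebraMap (MvPolynomial τ K) B)) := by
    obtain ⟨_, ⟨g, rfl⟩, hg1, hg2⟩ :=
      PrimeSpectrum.isTopologicalBasis_basic_opens.exists_subset_of_mem_open
        (Set.mem_range_self (⟨RingHom.ker z₁, RingHom.ker_isPrime _⟩ : PrimeSpectrum B))
        hopen.isOpen_range
    refine ⟨g, ?_, hg2⟩
    rw [← hz₁']
    exact hg1
  refine ⟨g, hg1, fun y hy => ?_⟩
  let : Algebra K B := ((algebraMap (MvPolynomial τ K) B).comp C).toAlgebra
  have : IsScalarTower K (MvPolynomial τ K) B := .of_algebraMap_eq fun _ => rfl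
  obtain ⟨z, hz⟩ := exists_algHom_of_mem_range_comap (B := B) (aeval y : MvPolynomial τ K →ₐ[K] K)
    (hg2 (by simpa [PrimeSpectrum.mem_basicOpen, RingHom.mem_ker, aeval_eq_eval] using hy))
  have hw : ∀ p, z (π p) = eval₂ (eval y) (fun s => z (π (X s))) p := by
    have : z.toRingHom.comp π.toRingHom = eval₂Hom (eval y) (fun s => z (π (X s))) := by
      refine MvPolynomial.ringHom_ext (fun a => ?_) fun s => by simp
      rw [coe_eval₂Hom, eval₂_C]
      change z (π (algebraMap _ _ a)) = _
      rw [π.commutes, hz, aeval_eq_eval]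
    exact fun p => DFunLike.congr_fun this p
  refine ⟨fun s => z (π (X s)), fun s => ?_, ?_⟩
  · rw [← hw, hπv, map_zero]
  · rw [← hw]
    exact (hπh.map z).ne_zero

end ImplicitFunction

/-! ### Hadamard's lemma -/

/-- Hadamard's lemma for polynomials. -/
theorem exists_eq_add_sum_X_mul {σ K : Type*} [Fintype σ] [DecidableEq σ] [CommRing K]
    (p : MvPolynomial σ K) :
    ∃ q : σ → MvPolynomial σ K, p = C (constantCoeff p) + ∑ s, X s * q s := by
  induction p using MvPolynomial.induction_on with
  | C a => exact ⟨0, by simp⟩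
  | add p q hp hq =>
    obtain ⟨a, ha⟩ := hp
    obtain ⟨b, hb⟩ := hq
    refine ⟨a + b, ?_⟩
    nth_rw 1 [ha, hb]
    simp [mul_add, Finset.sum_add_distrib]
    ring
  | mul_X p i _ =>
    refine ⟨Pi.single i p, ?_⟩
    simp [Pi.single_apply, mul_comm]

theorem exists_hadamard {σ K : Type*} [Fintype σ] [DecidableEq σ] [CommRing K]
    (p : MvPolynomial σ K) (x₀ : σ → K) :
    ∃ q : σ → MvPolynomial σ K, (∀ s, eval 0 (q s) = eval x₀ (pderiv s p)) ∧
      ∀ v, eval (x₀ + v) p = eval x₀ p + ∑ s, v s * eval v (q s) := by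
  let P : MvPolynomial σ K := aeval (fun s => C (x₀ s) + X s) p
  have hP : ∀ v, eval v P = eval (x₀ + v) p := fun v => by
    rw [← aeval_eq_eval, ← aeval_eq_eval]
    simp only [P, ← AlgHom.comp_apply, comp_aeval]
    congr 2
    ext s
    simp
  obtain ⟨q, hq⟩ := exists_eq_add_sum_X_mul P
  have hpd : ∀ s, eval 0 (pderiv s P) = eval x₀ (pderiv s p) := fun s => by
    -- The partial derivatives of `p` at `x₀` and of its translate at `0` are both the
    -- `ε`-coefficient of the same value, taken at `x₀ + ε e_s`.
    have h1 := eval₂_dualNumber (RingHom.id K) (0 : σ → K) (Pi.single s 1) P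
    have h2 := eval₂_dualNumber (RingHom.id K) x₀ (Pi.single s 1) p
    have h3 : eval₂ ((TrivSqZeroExt.inlHom K K).comp (RingHom.id K)) (fun t =>
        (TrivSqZeroExt.inl ((0 : σ → K) t) + TrivSqZeroExt.inr ((Pi.single s 1 : σ → K) t) :
          DualNumber K)) P = eval₂ ((TrivSqZeroExt.inlHom K K).comp (RingHom.id K)) (fun t =>
        (TrivSqZeroExt.inl (x₀ t) + TrivSqZeroExt.inr ((Pi.single s 1 : σ → K) t) :
          DualNumber K)) p := by
      simp only [P, ← coe_eval₂Hom]
      rw [← AlgHom.coe_toRingHom, ← RingHom.comp_apply]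
      congr 1
      refine MvPolynomial.ringHom_ext (fun a => ?_) fun t => ?_
      · simp [algebraMap_eq]
      · simp
    rw [h1, h2] at h3
    have h4 := congrArg TrivSqZeroExt.snd h3
    simpa [Pi.single_apply, eval₂_id] using h4
  refine ⟨q, fun s => ?_, fun v => ?_⟩
  · rw [← hpd, hq]
    simp [pderiv_X, Pi.single_apply, apply_ite]
  · have h0 : eval x₀ p = constantCoeff P := by
      rw [← eval_zero, hP, add_zero]
    rw [← hP, h0]
    conv_lhs => rw [hq]
    simp

/-! ### Structure tensors and their transformation by matrices -/

section Tensors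

variable {n : ℕ} {R S : Type*} [CommRing R] [CommRing S]

/-- The structure tensor `m k i j = X_{ij}^k` transformed by the matrix `X` in the arguments and
by the matrix `Y` in the values. -/
def transport (X Y : Matrix (Fin n) (Fin n) R) :
    (Fin n → Matrix (Fin n) (Fin n) R) →ₗ[R] (Fin n → Matrix (Fin n) (Fin n) R) where
  toFun m k := ∑ l, Y k l • (X.transpose * m l * X)
  map_add' m m' := by
    funext k
    simp [mul_add, add_mul, Finset.sum_add_distrib]
  map_smul' c m := by
    funext k
    simp [Finset.smul_sum, smul_comm c]

theorem transport_apply (X Y : Matrix (Fin n) (Fin n) R) (m : Fin n → Matrix (Fin n) (Fin n) R)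
    (k : Fin n) : transport X Y m k = ∑ l, Y k l • (X.transpose * m l * X) := rfl

/-- The infinitesimal version of `transport`, i.e. the coboundary operator on structure tensors. -/
def infTransport (a : Matrix (Fin n) (Fin n) R) (m : Fin n → Matrix (Fin n) (Fin n) R) :
    Fin n → Matrix (Fin n) (Fin n) R :=
  fun k => a.transpose * m k + m k * a - ∑ l, a k l • m l

/-- The coordinates `X_{ij}^k`, `i < j`, of a structure tensor. -/
def coords : (Fin n → Matrix (Fin n) (Fin n) R) →ₗ[R] (Idx n → R) where
  toFun m t := m t.1.2.2 t.1.1 t.1.2.1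
  map_add' _ _ := rfl
  map_smul' _ _ := rfl

/-- The skew-symmetric structure tensor with given coordinates. -/
def skewTensor : (Idx n → R) →ₗ[R] (Fin n → Matrix (Fin n) (Fin n) R) where
  toFun v k := Matrix.of fun i j =>
    if h : i < j then v ⟨(i, j, k), h⟩ else if h : j < i then -v ⟨(j, i, k), h⟩ else 0
  map_add' v w := by
    funext k
    ext i j
    simp only [Matrix.of_apply, Pi.add_apply, Matrix.add_apply]
    split_ifs <;> simp [add_comm]
  map_smul' c v := by
    funext k
    ext i j
    simp only [Matrix.of_apply, Pi.smul_apply, Matrix.smul_apply, RingHom.id_apply]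
    split_ifs <;> simp

theorem coords_apply (m : Fin n → Matrix (Fin n) (Fin n) R) (t : Idx n) :
    coords m t = m t.1.2.2 t.1.1 t.1.2.1 := rfl

theorem coords_skewTensor (v : Idx n → R) : coords (skewTensor v) = v := by
  funext t
  have h : t.1.1 < t.1.2.1 := t.2
  change (if h : t.1.1 < t.1.2.1 then v ⟨(t.1.1, t.1.2.1, t.1.2.2), h⟩ else _) = v t
  rw [dif_pos h]

theorem skewTensor_transpose (v : Idx n → R) (k : Fin n) :
    (skewTensor v k).transpose = -skewTensor v k := by
  ext i j
  simp only [skewTensor, LinearMap.coe_mk, AddHom.coe_mk, Matrix.transpose_apply, Matrix.of_apply,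
    Matrix.neg_apply]
  rcases lt_trichotomy i j with h | rfl | h
  · simp [h, h.not_gt]
  · simp
  · simp [h, h.not_gt]

theorem skewTensor_coords (h2 : IsUnit (2 : R)) (m : Fin n → Matrix (Fin n) (Fin n) R)
    (hm : ∀ k, (m k).transpose = -m k) : skewTensor (coords m) = m := by
  funext k
  ext i j
  have hs : ∀ i j, m k j i = -m k i j := fun i j => congrFun (congrFun (hm k) i) j
  simp only [skewTensor, LinearMap.coe_mk, AddHom.coe_mk, Matrix.of_apply, coords_apply]
  rcases lt_trichotomy i j with h | rfl | h
  · simp [h]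
  · simp only [lt_irrefl, dite_false]
    have h0 : (2 : R) * m k i i = 0 := by
      rw [two_mul]
      nth_rw 1 [hs i i]
      simp
    exact (h2.mul_right_eq_zero.1 h0).symm
  · simp [h, h.not_gt, hs j i]

theorem transport_transpose (X Y : Matrix (Fin n) (Fin n) R)
    (m : Fin n → Matrix (Fin n) (Fin n) R) (hm : ∀ k, (m k).transpose = -m k) (k : Fin n) :
    (transport X Y m k).transpose = -transport X Y m k := by
  simp [transport_apply, Matrix.transpose_sum, Matrix.transpose_mul, hm, Matrix.mul_assoc]

theorem infTransport_transpose (a : Matrix (Fin n) (Fin n) R)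
    (m : Fin n → Matrix (Fin n) (Fin n) R) (hm : ∀ k, (m k).transpose = -m k) (k : Fin n) :
    (infTransport a m k).transpose = -infTransport a m k := by
  simp [infTransport, Matrix.transpose_sum, Matrix.transpose_mul, hm, sub_eq_add_neg]
  abel

theorem transport_transport (X₁ X₂ Y₁ Y₂ : Matrix (Fin n) (Fin n) R)
    (m : Fin n → Matrix (Fin n) (Fin n) R) :
    transport X₂ Y₂ (transport X₁ Y₁ m) = transport (X₁ * X₂) (Y₂ * Y₁) m := by
  funext k
  simp only [transport_apply, Matrix.mul_sum, Matrix.sum_mul, Finset.smul_sum,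
    Matrix.mul_apply (M := Y₂),
    Finset.sum_smul, Matrix.transpose_mul, Matrix.mul_smul, Matrix.smul_mul, smul_smul]
  rw [Finset.sum_comm]
  simp only [Matrix.mul_assoc]

theorem transport_one (m : Fin n → Matrix (Fin n) (Fin n) R) : transport 1 1 m = m := by
  funext k
  simp [transport_apply, Matrix.one_apply]

theorem transport_map (f : R →+* S) (X Y : Matrix (Fin n) (Fin n) R)
    (m : Fin n → Matrix (Fin n) (Fin n) R) (k : Fin n) :
    (transport X Y m k).map f = transport (X.map f) (Y.map f) (fun l => (m l).map f) k := by
  ext i j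
  simp [transport_apply, Matrix.sum_apply, Matrix.mul_apply]

theorem skewTensor_map (f : R →+* S) (v : Idx n → R) (k : Fin n) :
    (skewTensor v k).map f = skewTensor (fun t => f (v t)) k := by
  ext i j
  simp only [skewTensor, LinearMap.coe_mk, AddHom.coe_mk, Matrix.map_apply, Matrix.of_apply]
  split_ifs <;> simp

/-- All terms of order two vanish as `ε² = 0`. The matrices `a` and `c` are independent: the orbit
map needs `c = -a`, the slice equations need one of them to be `0`. -/
theorem transport_dualNumber (a c : Matrix (Fin n) (Fin n) R)
    (m : Fin n → Matrix (Fin n) (Fin n) R) (k : Fin n) :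
    transport (1 + a.map (TrivSqZeroExt.inr : R → DualNumber R))
        (1 + c.map (TrivSqZeroExt.inr : R → DualNumber R))
        (fun l => (m l).map (TrivSqZeroExt.inl : R → DualNumber R)) k =
      (m k).map (TrivSqZeroExt.inl : R → DualNumber R) +
        (a.transpose * m k + m k * a + ∑ l, c k l • m l).map TrivSqZeroExt.inr := by
  have h1 : ∀ l, (1 + a.map (TrivSqZeroExt.inr : R → DualNumber R)).transpose *
      (m l).map (TrivSqZeroExt.inl : R → DualNumber R) *
        (1 + a.map (TrivSqZeroExt.inr : R → DualNumber R)) =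
      (m l).map (TrivSqZeroExt.inl : R → DualNumber R) +
        (a.transpose * m l + m l * a).map TrivSqZeroExt.inr := by
    intro l
    have e1 : (a.map (TrivSqZeroExt.inr : R → DualNumber R)).transpose *
        (m l).map (TrivSqZeroExt.inl : R → DualNumber R) =
        (a.transpose * m l).map TrivSqZeroExt.inr := by
      ext i j <;> simp [Matrix.mul_apply, TrivSqZeroExt.fst_sum, TrivSqZeroExt.snd_sum,
        -DualNumber.inr_eq_smul_eps, mul_comm]
    have e2 : (m l).map (TrivSqZeroExt.inl : R → DualNumber R) *
        a.map (TrivSqZeroExt.inr : R → DualNumber R) = (m l * a).map TrivSqZeroExt.inr := by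
      ext i j <;> simp [Matrix.mul_apply, TrivSqZeroExt.fst_sum, TrivSqZeroExt.snd_sum,
        -DualNumber.inr_eq_smul_eps]
    have e3 : (a.transpose * m l).map (TrivSqZeroExt.inr : R → DualNumber R) *
        a.map (TrivSqZeroExt.inr : R → DualNumber R) = 0 := by
      ext i j <;> simp [Matrix.mul_apply, -DualNumber.inr_eq_smul_eps]
    rw [Matrix.transpose_add, Matrix.transpose_one, add_mul, one_mul, mul_add, mul_one, e1, add_mul,
      e2, e3, Matrix.map_add _ (TrivSqZeroExt.inr_add R)]
    abel
  simp only [transport_apply, h1]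
  ext i j
  · simp [Matrix.sum_apply, Matrix.one_apply, apply_ite, TrivSqZeroExt.fst_sum,
      -DualNumber.inr_eq_smul_eps]
  · simp [Matrix.sum_apply, Matrix.one_apply, add_mul, TrivSqZeroExt.snd_sum,
      -DualNumber.inr_eq_smul_eps, Finset.sum_add_distrib]
    rw [add_comm]

theorem transport_inl_inr (X Y : Matrix (Fin n) (Fin n) R)
    (m : Fin n → Matrix (Fin n) (Fin n) R) (k : Fin n) :
    transport (X.map (TrivSqZeroExt.inl : R → DualNumber R)) (Y.map TrivSqZeroExt.inl)
        (fun l => (m l).map (TrivSqZeroExt.inr : R → DualNumber R)) k =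
      (transport X Y m k).map (TrivSqZeroExt.inr : R → DualNumber R) := by
  ext i j <;> simp [transport_apply, Matrix.sum_apply, Matrix.mul_apply, TrivSqZeroExt.fst_sum,
    TrivSqZeroExt.snd_sum, -DualNumber.inr_eq_smul_eps, mul_comm]

end Tensors

/-! ### Multiplications in terms of structure constants -/

section Coordinates

variable {K : Type*} [Field K] {E : Type*} [AddCommGroup E] [Module K E] {n : ℕ}
  (b : Module.Basis (Fin n) K E)

/-- The full structure tensor of a multiplication. -/
noncomputable def tensor (μ : SBil K E) : Fin n → Matrix (Fin n) (Fin n) K :=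
  fun k => Matrix.of fun i j => b.repr (μ.1 (b i) (b j)) k

theorem coords_tensor (μ : SBil K E) : coords (tensor b μ) = structConst b μ := rfl

theorem tensor_transpose (μ : SBil K E) (k : Fin n) :
    (tensor b μ k).transpose = -tensor b μ k := by
  ext i j
  have h := congrArg (fun x => b.repr x k) (SBil_skew μ (b i) (b j))
  simp only [map_add, Finsupp.add_apply, map_zero, Finsupp.zero_apply] at h
  exact eq_neg_of_add_eq_zero_right h

theorem tensor_injective : Function.Injective (tensor b) := by
  intro μ ν h
  refine Subtype.ext (b.ext fun i => b.ext fun j => b.repr.injective (Finsupp.ext fun k => ?_))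
  exact congrFun (congrFun (congrFun h k) i) j

theorem exists_structConst_eq (v : Idx n → K) : ∃ μ : SBil K E, structConst b μ = v := by
  let B : E →ₗ[K] E →ₗ[K] E := b.constr K fun i => b.constr K fun j =>
    ∑ k, skewTensor v k i j • b k
  have hB : ∀ i j, B (b i) (b j) = ∑ k, skewTensor v k i j • b k := by simp [B]
  have hd : ∀ i, B (b i) (b i) = 0 := fun i => by
    rw [hB]
    exact Finset.sum_eq_zero fun k _ => by simp [skewTensor]
  have hs : ∀ i j, B (b i) (b j) = -B (b j) (b i) := fun i j => by
    rw [hB, hB, ← Finset.sum_neg_distrib]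
    refine Finset.sum_congr rfl fun k _ => ?_
    have := congrFun (congrFun (skewTensor_transpose v k) j) i
    rw [Matrix.transpose_apply, Matrix.neg_apply] at this
    rw [this, neg_smul]
  have hskew : B = -B.flip := b.ext fun i => b.ext fun j => hs i j
  -- Skewness and the zero diagonal on the basis give this by induction on the expansion of `x`,
  -- without dividing by `2`.
  have halt : ∀ x, B x x = 0 := by
    intro x
    rw [← b.sum_repr x]
    induction (Finset.univ : Finset (Fin n)) using Finset.induction_on with
    | empty => simp
    | insert i s hi ih =>
      rw [Finset.sum_insert hi]
      have h1 := congrArg (fun C => C (∑ j ∈ s, b.repr x j • b j) (b.repr x i • b i)) hskew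
      simp only [LinearMap.neg_apply, LinearMap.flip_apply] at h1
      simp only [map_add, LinearMap.add_apply, ih, h1]
      simp [hd]
  refine ⟨⟨B, halt⟩, ?_⟩
  rw [← coords_tensor, ← coords_skewTensor v]
  congr 1
  funext k
  ext i j
  simp [tensor, hB, Finsupp.single_apply]

theorem tensor_act (f : E ≃ₗ[K] E) (μ : SBil K E) :
    tensor b (act f μ) = transport (LinearMap.toMatrix b b f) (LinearMap.toMatrix b b f.symm)
      (tensor b μ) := by
  funext k
  ext i j
  have h1 : ∀ x, b.repr (f.symm x) k = ∑ l, LinearMap.toMatrix b b f.symm k l * b.repr x l := by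
    intro x
    have := congrFun (LinearMap.toMatrix_mulVec_repr b b (f.symm : E →ₗ[K] E) x) k
    exact this.symm
  have h2 : ∀ i, f (b i) = ∑ p, LinearMap.toMatrix b b f p i • b p := by
    intro i
    simp [LinearMap.toMatrix_apply, b.sum_repr]
  simp only [tensor, act, Matrix.of_apply, LinearMap.mk₂_apply, h1, transport_apply,
    Matrix.sum_apply, Matrix.smul_apply, smul_eq_mul]
  refine Finset.sum_congr rfl fun l _ => ?_
  congr 1
  rw [h2 i, h2 j]
  simp only [map_sum, LinearMap.sum_apply, map_smul, LinearMap.smul_apply, Finsupp.coe_finsetSum,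
    Finset.sum_apply, Finsupp.smul_apply, smul_eq_mul, Matrix.mul_apply, Matrix.transpose_apply,
    Matrix.of_apply, Finset.sum_mul, Finset.mul_sum]
  exact Finset.sum_congr rfl fun p _ => Finset.sum_congr rfl fun q _ => by ring

theorem tensor_coboundary (f : E →ₗ[K] E) (μ : SBil K E) :
    tensor b (coboundary μ f) = infTransport (LinearMap.toMatrix b b f) (tensor b μ) := by
  funext k
  ext i j
  have h1 : ∀ x, b.repr (f x) k = ∑ l, LinearMap.toMatrix b b f k l * b.repr x l := by
    intro x
    have := congrFun (LinearMap.toMatrix_mulVec_repr b b f x) k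
    exact this.symm
  have h2 : ∀ i, f (b i) = ∑ p, LinearMap.toMatrix b b f p i • b p := by
    intro i
    simp [LinearMap.toMatrix_apply, b.sum_repr]
  simp only [tensor, coboundary, Matrix.of_apply, LinearMap.coe_mk, AddHom.coe_mk,
    LinearMap.mk₂_apply, map_sub, map_add, Finsupp.sub_apply, Finsupp.add_apply, h1, infTransport,
    Matrix.sub_apply, Matrix.add_apply, Matrix.sum_apply, Matrix.smul_apply, smul_eq_mul,
    Matrix.mul_apply, Matrix.transpose_apply]
  rw [h2 i, h2 j]
  simp [mul_comm]

theorem exists_equiv_of_isUnit_det (F : Matrix (Fin n) (Fin n) K) (hF : IsUnit F.det) :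
    ∃ f : E ≃ₗ[K] E, ∀ μ, tensor b (act f μ) = transport F F⁻¹ (tensor b μ) := by
  let f : E ≃ₗ[K] E := LinearEquiv.ofLinearMap (Matrix.toLin b b F) (Matrix.toLin b b F⁻¹)
    (by rw [← Matrix.toLin_mul, Matrix.mul_nonsing_inv _ hF, Matrix.toLin_one])
    (by rw [← Matrix.toLin_mul, Matrix.nonsing_inv_mul _ hF, Matrix.toLin_one])
  refine ⟨f, fun μ => ?_⟩
  rw [tensor_act]
  have h1 : LinearMap.toMatrix b b (f : E →ₗ[K] E) = F := LinearMap.toMatrix_toLin b b F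
  have h2 : LinearMap.toMatrix b b (f.symm : E →ₗ[K] E) = F⁻¹ := LinearMap.toMatrix_toLin b b F⁻¹
  rw [h1, h2]

theorem act_symm_act (f : E ≃ₗ[K] E) (μ : SBil K E) : act f.symm (act f μ) = μ := by
  ext x y
  simp [act]

theorem act_act (f g : E ≃ₗ[K] E) (μ : SBil K E) : act f (act g μ) = act (f.trans g) μ := by
  ext x y
  simp [act]

variable [CharZero K]

theorem isUnit_two_of_algebra (K : Type*) {R : Type*} [Field K] [CharZero K] [CommRing R]
    [Algebra K R] : IsUnit (2 : R) := by
  have h := (isUnit_iff_ne_zero.2 (two_ne_zero (α := K))).map (algebraMap K R)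
  rwa [map_ofNat] at h

theorem skewTensor_structConst (μ : SBil K E) : skewTensor (structConst b μ) = tensor b μ :=
  skewTensor_coords (isUnit_two_of_algebra K) _ (tensor_transpose b μ)

theorem structConst_injective : Function.Injective (structConst b) := fun μ ν h =>
  tensor_injective b (by rw [← skewTensor_structConst, ← skewTensor_structConst, h])


end Coordinates

/-! ### The generic invertible matrix -/

section GenericMatrix

variable (n : ℕ) (K : Type*) [Field K]

/-- The coordinate ring of the general linear group. -/
abbrev GLRing : Type _ := Localization.Away (Matrix.mvPolynomialX (Fin n) (Fin n) K).det

/-- The generic invertible matrix. -/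
noncomputable def genericMatrix : Matrix (Fin n) (Fin n) (GLRing n K) :=
  (Matrix.mvPolynomialX (Fin n) (Fin n) K).map (algebraMap _ (GLRing n K))

variable {n K}

theorem isUnit_det_genericMatrix : IsUnit (genericMatrix n K).det := by
  have h := IsLocalization.Away.algebraMap_isUnit (S := GLRing n K)
    (Matrix.mvPolynomialX (Fin n) (Fin n) K).det
  rwa [RingHom.map_det] at h

theorem exists_glRing_lift {S : Type*} [CommRing S] [Algebra K S] (Z : Matrix (Fin n) (Fin n) S)
    (hZ : IsUnit Z.det) : ∃ φ : GLRing n K →ₐ[K] S, (genericMatrix n K).map φ = Z := by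
  let ψ : MvPolynomial (Fin n × Fin n) K →ₐ[K] S := aeval fun p => Z p.1 p.2
  have hψZ : (Matrix.mvPolynomialX (Fin n) (Fin n) K).map ψ = Z := by
    ext i j
    simp [ψ]
  have hψ : IsUnit (ψ (Matrix.mvPolynomialX (Fin n) (Fin n) K).det) := by
    rw [AlgHom.map_det]
    change IsUnit ((Matrix.mvPolynomialX (Fin n) (Fin n) K).map ψ).det
    rwa [hψZ]
  have hl : ∀ a, IsLocalization.Away.lift _ hψ (algebraMap _ (GLRing n K) a) = ψ a :=
    fun a => IsLocalization.Away.lift_eq _ hψ a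
  refine ⟨{ IsLocalization.Away.lift (S := GLRing n K) _ hψ with
    commutes' := fun c => ?_ }, ?_⟩
  · change IsLocalization.Away.lift _ hψ (algebraMap K (GLRing n K) c) = _
    rw [IsScalarTower.algebraMap_apply K (MvPolynomial (Fin n × Fin n) K), hl]
    exact ψ.commutes c
  · rw [← hψZ]
    ext i j
    exact hl _

theorem glRing_eq_zero [Infinite K] (z : GLRing n K) (hz : ∀ φ : GLRing n K →ₐ[K] K, φ z = 0) :
    z = 0 := by
  obtain ⟨a, ⟨_, k, rfl⟩, rfl⟩ := IsLocalization.exists_mk'_eq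
    (Submonoid.powers (Matrix.mvPolynomialX (Fin n) (Fin n) K).det) z
  rw [IsLocalization.mk'_eq_zero_iff]
  -- It suffices that `det * a` vanishes at every matrix: at invertible ones by the hypothesis on
  -- `z`, at singular ones because of the factor `det`.
  refine ⟨⟨_, 1, rfl⟩, ?_⟩
  simp only [pow_one]
  refine MvPolynomial.funext fun x => ?_
  rw [map_mul, map_zero]
  by_cases hx : IsUnit (Matrix.of fun i j => x (i, j)).det
  · obtain ⟨φ, hφ⟩ := exists_glRing_lift (K := K) _ hx
    have h0 : φ.comp (IsScalarTower.toAlgHom K _ (GLRing n K)) = aeval x := by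
      refine MvPolynomial.algHom_ext fun p => ?_
      have := congrFun (congrFun hφ p.1) p.2
      simpa [genericMatrix] using this
    have h1 := hz φ
    have h2 := congrArg φ (IsLocalization.mk'_spec (GLRing n K) a
      (⟨_, k, rfl⟩ : Submonoid.powers (Matrix.mvPolynomialX (Fin n) (Fin n) K).det))
    rw [map_mul, h1, zero_mul] at h2
    have h3 := DFunLike.congr_fun h0 a
    simp only [AlgHom.comp_apply, IsScalarTower.coe_toAlgHom', ← h2, aeval_eq_eval] at h3
    rw [← h3, mul_zero]
  · have : eval x (Matrix.mvPolynomialX (Fin n) (Fin n) K).det =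
        (Matrix.of fun i j => x (i, j)).det := by
      rw [RingHom.map_det]
      congr 1
      ext i j
      simp
    rw [this, not_not.1 (mt isUnit_iff_ne_zero.2 hx), zero_mul]

theorem map_inv_of_isUnit_det {R S : Type*} [CommRing R] [CommRing S] (f : R →+* S)
    (X : Matrix (Fin n) (Fin n) R) (hX : IsUnit X.det) : X⁻¹.map f = (X.map f)⁻¹ := by
  refine (Matrix.inv_eq_right_inv ?_).symm
  rw [← Matrix.map_mul, Matrix.mul_nonsing_inv _ hX]
  simp

end GenericMatrix

/-! ### The tangent space of an orbit -/

section Orbits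

variable {K : Type*} [Field K]

theorem aeval_dualNumber {σ R : Type*} [Fintype σ] [CommRing R] [Algebra K R] (x v : σ → R)
    (p : MvPolynomial σ K) :
    aeval (fun s => (TrivSqZeroExt.inl (x s) + TrivSqZeroExt.inr (v s) : DualNumber R)) p =
      TrivSqZeroExt.inl (aeval x p) +
        TrivSqZeroExt.inr (∑ s, aeval x (pderiv s p) * v s) :=
  eval₂_dualNumber (algebraMap K R) x v p

/-- The pullback of a polynomial function along a linear map. -/
noncomputable def linPullback {σ : Type*} [Fintype σ] [DecidableEq σ]
    (L : (σ → K) →ₗ[K] (σ → K)) (p : MvPolynomial σ K) : MvPolynomial σ K :=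
  aeval (fun t => ∑ s, C (L (Pi.single s 1) t) * X s) p

theorem linPullback_aux {σ : Type*} [Fintype σ] [DecidableEq σ]
    (L : (σ → K) →ₗ[K] (σ → K)) (x : σ → K) (t : σ) :
    ∑ s, L (Pi.single s 1) t * x s = L x t := by
  conv_rhs => rw [← Finset.univ_sum_single x]
  simp only [map_sum, Finset.sum_apply]
  refine Finset.sum_congr rfl fun s _ => ?_
  rw [show (Pi.single s (x s) : σ → K) = x s • Pi.single s 1 by
    rw [← Pi.single_smul]; simp, map_smul, Pi.smul_apply, smul_eq_mul, mul_comm]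

theorem aeval_linPullback {σ : Type*} [Fintype σ] [DecidableEq σ] {R : Type*} [CommRing R]
    [Algebra K R] (L : (σ → K) →ₗ[K] (σ → K)) (p : MvPolynomial σ K) (x : σ → R) :
    aeval x (linPullback L p) =
      aeval (fun t => ∑ s, algebraMap K R (L (Pi.single s 1) t) * x s) p := by
  rw [linPullback, ← AlgHom.comp_apply, comp_aeval]
  congr 2
  funext t
  simp

theorem eval_linPullback {σ : Type*} [Fintype σ] [DecidableEq σ]
    (L : (σ → K) →ₗ[K] (σ → K)) (p : MvPolynomial σ K) (x : σ → K) :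
    eval x (linPullback L p) = eval (L x) p := by
  rw [← aeval_eq_eval, ← aeval_eq_eval, aeval_linPullback]
  congr 2
  funext t
  exact linPullback_aux L x t

theorem sum_pderiv_linPullback {σ : Type*} [Fintype σ] [DecidableEq σ]
    (L : (σ → K) →ₗ[K] (σ → K)) (p : MvPolynomial σ K) (x v : σ → K) :
    ∑ s, eval x (pderiv s (linPullback L p)) * v s =
      ∑ t, eval (L x) (pderiv t p) * L v t := by
  have h1 := aeval_dualNumber x v (linPullback L p)
  have h2 := aeval_dualNumber (L x) (L v) p
  have h3 : (fun t => ∑ s, algebraMap K (DualNumber K) (L (Pi.single s 1) t) *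
      (TrivSqZeroExt.inl (x s) + TrivSqZeroExt.inr (v s) : DualNumber K)) =
      fun t => (TrivSqZeroExt.inl (L x t) + TrivSqZeroExt.inr (L v t) : DualNumber K) := by
    funext t
    rw [← linPullback_aux L x t, ← linPullback_aux L v t]
    ext <;> simp [TrivSqZeroExt.fst_sum, TrivSqZeroExt.snd_sum, -DualNumber.inr_eq_smul_eps,
      TrivSqZeroExt.algebraMap_eq_inl]
  rw [aeval_linPullback, h3, h2] at h1
  have h4 := congrArg TrivSqZeroExt.snd h1
  simpa [aeval_eq_eval, -DualNumber.inr_eq_smul_eps] using h4.symm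

variable {E : Type*} [AddCommGroup E] [Module K E] {n : ℕ}
  (b : Module.Basis (Fin n) K E)

theorem exists_linear_act [CharZero K] (f : E ≃ₗ[K] E) : ∃ L : (Idx n → K) →ₗ[K] (Idx n → K),
    ∀ ν, L (structConst b ν) = structConst b (act f ν) := by
  refine ⟨coords ∘ₗ transport (LinearMap.toMatrix b b f) (LinearMap.toMatrix b b f.symm) ∘ₗ
    skewTensor, fun ν => ?_⟩
  simp only [LinearMap.comp_apply]
  rw [skewTensor_structConst, ← tensor_act, coords_tensor]

theorem mem_tangentSpace_iff {S : Set (SBil K E)} {μ φ : SBil K E} :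
    φ ∈ tangentSpace b S μ ↔ ∀ p ∈ vanishingIdeal K (structConst b '' S),
      ∑ t, eval (structConst b μ) (pderiv t p) * structConst b φ t = 0 := Iff.rfl

/-- The action is linear in the coordinates, and stability makes the pullback of an equation of `S`
again an equation of `S`; the chain rule does the rest. -/
theorem act_mem_tangentSpace [CharZero K] {S : Set (SBil K E)} (hS : IsStable S) {μ φ : SBil K E}
    (hφ : φ ∈ tangentSpace b S μ) (f : E ≃ₗ[K] E) :
    act f φ ∈ tangentSpace b S (act f μ) := by
  rw [mem_tangentSpace_iff] at hφ ⊢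
  intro p hp
  obtain ⟨L, hL⟩ := exists_linear_act b f
  have h := hφ (linPullback L p) (by
    rw [mem_vanishingIdeal_iff] at hp ⊢
    rintro _ ⟨ν, hν, rfl⟩
    have := hp _ ⟨_, hS ν hν f, rfl⟩
    rw [aeval_eq_eval] at this ⊢
    rw [eval_linPullback, hL, this])
  rw [sum_pderiv_linPullback] at h
  simpa only [hL] using h

theorem isStable_orbit (μ : SBil K E) : IsStable (orbit μ) := by
  rintro _ ⟨f, rfl⟩ g
  exact ⟨g.trans f, (act_act g f μ).symm⟩

/-- The coordinates of the generic point of the orbit of `m`. -/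
noncomputable def orbitPoint (m : Fin n → Matrix (Fin n) (Fin n) K) : Idx n → GLRing n K :=
  coords (transport (genericMatrix n K) (genericMatrix n K)⁻¹
    (fun l => (m l).map (algebraMap K (GLRing n K))))

theorem map_orbitPoint {S : Type*} [CommRing S] [Algebra K S] (g : GLRing n K →ₐ[K] S)
    (m : Fin n → Matrix (Fin n) (Fin n) K) (t : Idx n) :
    g (orbitPoint m t) = coords (transport ((genericMatrix n K).map g)
      ((genericMatrix n K).map g)⁻¹ (fun l => (m l).map (algebraMap K S))) t := by
  have h1 := map_inv_of_isUnit_det (g : GLRing n K →+* S) _ isUnit_det_genericMatrix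
  rw [orbitPoint, coords_apply, coords_apply]
  have h2 := transport_map (g : GLRing n K →+* S) (genericMatrix n K) (genericMatrix n K)⁻¹
    (fun l => (m l).map (algebraMap K (GLRing n K))) t.1.2.2
  have h3 := congrFun (congrFun h2 t.1.1) t.1.2.1
  rw [h1] at h3
  have h4 : ∀ l, ((m l).map (algebraMap K (GLRing n K))).map (g : GLRing n K →+* S) =
      (m l).map (algebraMap K S) := fun l => by
    ext i j
    simp
  simp only [h4] at h3
  exact h3

theorem isUnit_det_map_genericMatrix {S : Type*} [CommRing S] [Algebra K S]
    (g : GLRing n K →ₐ[K] S) : IsUnit ((genericMatrix n K).map g).det := by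
  have h := (isUnit_det_genericMatrix (n := n) (K := K)).map g
  rwa [AlgHom.map_det] at h

theorem exists_act_eq_orbitPoint (g : GLRing n K →ₐ[K] K) :
    ∃ f : E ≃ₗ[K] E, ∀ ν t, g (orbitPoint (tensor b ν) t) = structConst b (act f ν) t := by
  obtain ⟨f, hf⟩ := exists_equiv_of_isUnit_det b _ (isUnit_det_map_genericMatrix g)
  refine ⟨f, fun ν t => ?_⟩
  rw [map_orbitPoint, ← coords_tensor, hf]
  rfl

/-- This turns vanishing on the `K`-points of the orbit into one identity over the coordinate ring
of `GL`, which can be specialised to any `K`-algebra, in particular to the dual numbers. -/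
theorem mem_vanishingIdeal_orbit_iff [CharZero K] (μ : SBil K E) (p : MvPolynomial (Idx n) K) :
    p ∈ vanishingIdeal K (structConst b '' orbit μ) ↔
      aeval (orbitPoint (tensor b μ)) p = 0 := by
  rw [mem_vanishingIdeal_iff]
  have key : ∀ g : GLRing n K →ₐ[K] K, g (aeval (orbitPoint (tensor b μ)) p) =
      aeval (fun t => g (orbitPoint (tensor b μ) t)) p := fun g => by
    rw [← AlgHom.comp_apply, comp_aeval]
  constructor
  · intro h
    refine glRing_eq_zero _ fun g => ?_
    obtain ⟨f, hf⟩ := exists_act_eq_orbitPoint b g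
    rw [key]
    simp only [hf]
    exact h _ ⟨_, ⟨f, rfl⟩, rfl⟩
  · rintro h _ ⟨_, ⟨f, rfl⟩, rfl⟩
    have hF : LinearMap.toMatrix b b (f : E →ₗ[K] E) * LinearMap.toMatrix b b
        (f.symm : E →ₗ[K] E) = 1 := by
      rw [← LinearMap.toMatrix_comp]
      simp
    obtain ⟨g, hg⟩ := exists_glRing_lift (K := K) (LinearMap.toMatrix b b (f : E →ₗ[K] E))
      (Matrix.isUnit_det_of_right_inverse hF)
    have h1 := key g
    rw [h, map_zero] at h1
    have h2 : ∀ t, g (orbitPoint (tensor b μ) t) = structConst b (act f μ) t := fun t => by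
      rw [map_orbitPoint, hg, Matrix.inv_eq_right_inv hF, ← coords_tensor, tensor_act]
      rfl
    simp only [h2] at h1
    exact h1.symm

theorem one_add_inr_mul {R : Type*} [CommRing R] (a : Matrix (Fin n) (Fin n) R) :
    (1 + a.map (TrivSqZeroExt.inr : R → DualNumber R)) *
      (1 + (-a).map (TrivSqZeroExt.inr : R → DualNumber R)) = 1 := by
  have h1 : a.map (TrivSqZeroExt.inr : R → DualNumber R) *
      (-a).map (TrivSqZeroExt.inr : R → DualNumber R) = 0 := by
    ext i j <;> simp [Matrix.mul_apply, -DualNumber.inr_eq_smul_eps]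
  have h2 : (-a).map (TrivSqZeroExt.inr : R → DualNumber R) = -a.map TrivSqZeroExt.inr := by
    ext i j <;> simp [-DualNumber.inr_eq_smul_eps]
  rw [add_mul, mul_add, mul_add, h1, h2]
  simp

theorem transport_dualNumber_infTransport {R : Type*} [CommRing R] (a : Matrix (Fin n) (Fin n) R)
    (m : Fin n → Matrix (Fin n) (Fin n) R) (k : Fin n) :
    transport (1 + a.map (TrivSqZeroExt.inr : R → DualNumber R))
        (1 + (-a).map (TrivSqZeroExt.inr : R → DualNumber R))
        (fun l => (m l).map (TrivSqZeroExt.inl : R → DualNumber R)) k =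
      (m k).map (TrivSqZeroExt.inl : R → DualNumber R) +
        (infTransport a m k).map TrivSqZeroExt.inr := by
  rw [transport_dualNumber]
  simp [infTransport, sub_eq_add_neg]

theorem B2_le_tangentSpace_orbit [CharZero K] (μ : SBil K E) :
    B2 μ ≤ tangentSpace b (orbit μ) μ := by
  rintro _ ⟨f, rfl⟩
  rw [mem_tangentSpace_iff]
  intro p hp
  rw [mem_vanishingIdeal_orbit_iff] at hp
  have ha := one_add_inr_mul (LinearMap.toMatrix b b f)
  obtain ⟨g, hg⟩ := exists_glRing_lift (K := K) _ (Matrix.isUnit_det_of_right_inverse ha)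
  have h1 := congrArg g hp
  rw [map_zero, ← AlgHom.comp_apply, comp_aeval] at h1
  have h2 : (fun t => g (orbitPoint (tensor b μ) t)) = fun t =>
      (TrivSqZeroExt.inl (structConst b μ t) +
        TrivSqZeroExt.inr (structConst b (coboundary μ f) t) : DualNumber K) := by
    funext t
    rw [map_orbitPoint, hg, Matrix.inv_eq_right_inv ha, ← coords_tensor, ← coords_tensor,
      tensor_coboundary]
    exact congrFun (congrFun (transport_dualNumber_infTransport (LinearMap.toMatrix b b f)
      (tensor b μ) t.1.2.2) t.1.1) t.1.2.1
  rw [h2, aeval_dualNumber] at h1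
  have h3 := congrArg TrivSqZeroExt.snd h1
  simpa [aeval_eq_eval, -DualNumber.inr_eq_smul_eps] using h3

/-- At each `K`-point of `GL` this is the tangency of a translate of `φ` to the orbit, and
`K`-points detect zero in `GLRing`. -/
theorem sum_aeval_orbitPoint_eq_zero [CharZero K] {μ φ : SBil K E}
    (hφ : φ ∈ tangentSpace b (orbit μ) μ)
    {p : MvPolynomial (Idx n) K} (hp : p ∈ vanishingIdeal K (structConst b '' orbit μ)) :
    ∑ t, aeval (orbitPoint (tensor b μ)) (pderiv t p) * orbitPoint (tensor b φ) t = 0 := by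
  refine glRing_eq_zero _ fun g => ?_
  obtain ⟨f, hf⟩ := exists_act_eq_orbitPoint b g
  have h := (mem_tangentSpace_iff b).1
    (act_mem_tangentSpace b (isStable_orbit μ) hφ f) p hp
  rw [← h, map_sum]
  refine Finset.sum_congr rfl fun t _ => ?_
  rw [map_mul, hf, ← AlgHom.comp_apply, comp_aeval]
  simp only [hf]
  rfl

/-- A cochain that is a coboundary after an extension of the scalars is a coboundary. -/
theorem mem_B2_of_infTransport_eq {M : Type*} [Field M] [Algebra K M] {μ φ : SBil K E}
    (a : Matrix (Fin n) (Fin n) M)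
    (ha : ∀ k, infTransport a (fun l => (tensor b μ l).map (algebraMap K M)) k =
      (tensor b φ k).map (algebraMap K M)) : φ ∈ B2 μ := by
  obtain ⟨ρ, hρ⟩ := LinearMap.exists_leftInverse_of_injective (Algebra.linearMap K M)
    (LinearMap.ker_eq_bot.2 (algebraMap K M).injective)
  have hρ1 : ∀ c, ρ (algebraMap K M c) = c := fun c => LinearMap.congr_fun hρ c
  have hρ2 : ∀ c x, ρ (algebraMap K M c * x) = c * ρ x := fun c x => by
    rw [← Algebra.smul_def, map_smul, smul_eq_mul]
  have hρ3 : ∀ c x, ρ (x * algebraMap K M c) = ρ x * c := fun c x => by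
    rw [mul_comm, hρ2, mul_comm]
  refine ⟨Matrix.toLin b b (a.map ρ), tensor_injective b ?_⟩
  rw [tensor_coboundary, LinearMap.toMatrix_toLin]
  funext k
  ext i j
  have h := congrArg ρ (congrFun (congrFun (ha k) i) j)
  rw [Matrix.map_apply, hρ1] at h
  rw [← h]
  simp [infTransport, Matrix.mul_apply, Matrix.sum_apply, hρ2, hρ3]

theorem coords_injOn [CharZero K] {R : Type*} [CommRing R] [Algebra K R]
    {m m' : Fin n → Matrix (Fin n) (Fin n) R} (hm : ∀ k, (m k).transpose = -m k)
    (hm' : ∀ k, (m' k).transpose = -m' k) (h : coords m = coords m') : m = m' := by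
  rw [← skewTensor_coords (isUnit_two_of_algebra K) m hm, h,
    skewTensor_coords (isUnit_two_of_algebra K) m' hm']

theorem map_dual_eq {M : Type*} [Field M] [Algebra K M] (X : Matrix (Fin n) (Fin n) M)
    (hX : IsUnit X.det) (D : M →ₐ[K] DualNumber M) (hD : ∀ x, (D x).fst = x) :
    ∃ a : Matrix (Fin n) (Fin n) M,
      X.map D = (1 + a.map (TrivSqZeroExt.inr : M → DualNumber M)) *
        X.map (TrivSqZeroExt.inl : M → DualNumber M) := by
  -- The logarithmic derivative of `X`.
  refine ⟨X.map (fun x => (D x).snd) * X⁻¹, ?_⟩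
  have h1 : ∀ a : Matrix (Fin n) (Fin n) M, a.map (TrivSqZeroExt.inr : M → DualNumber M) *
      X.map (TrivSqZeroExt.inl : M → DualNumber M) = (a * X).map TrivSqZeroExt.inr := fun a => by
    ext i j
    · simp [Matrix.mul_apply, TrivSqZeroExt.fst_sum, -DualNumber.inr_eq_smul_eps]
    · simp [Matrix.mul_apply, TrivSqZeroExt.snd_sum, -DualNumber.inr_eq_smul_eps, mul_comm]
  rw [add_mul, h1, one_mul, Matrix.mul_assoc, Matrix.nonsing_inv_mul _ hX, Matrix.mul_one]
  ext i j <;> simp [hD, -DualNumber.inr_eq_smul_eps]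

theorem map_inl_mul_map_inl_inv {M : Type*} [CommRing M] (X : Matrix (Fin n) (Fin n) M)
    (hX : IsUnit X.det) : X.map (TrivSqZeroExt.inl : M → DualNumber M) *
      X⁻¹.map (TrivSqZeroExt.inl : M → DualNumber M) = 1 := by
  have h := (Matrix.map_mul (f := TrivSqZeroExt.inlHom M M) (L := X) (M := X⁻¹)).symm
  rw [Matrix.mul_nonsing_inv _ hX] at h
  refine Eq.trans h ?_
  simp

theorem transpose_inl_add_inr {M : Type*} [CommRing M] (m m' : Matrix (Fin n) (Fin n) M)
    (hm : m.transpose = -m) (hm' : m'.transpose = -m') :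
    (m.map (TrivSqZeroExt.inl : M → DualNumber M) + m'.map TrivSqZeroExt.inr).transpose =
      -(m.map (TrivSqZeroExt.inl : M → DualNumber M) + m'.map TrivSqZeroExt.inr) := by
  rw [Matrix.transpose_add, ← Matrix.transpose_map, ← Matrix.transpose_map, hm, hm']
  ext i j <;> simp [-DualNumber.inr_eq_smul_eps]

/-- A derivation of the scalars acts on the generic point of an orbit through the coboundary
operator. -/
theorem exists_infTransport_eq [CharZero K] {M : Type*} [Field M] [Algebra K M]
    (X : Matrix (Fin n) (Fin n) M) (hX : IsUnit X.det) (D : M →ₐ[K] DualNumber M)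
    (hD : ∀ x, (D x).fst = x) (m m' : Fin n → Matrix (Fin n) (Fin n) M)
    (hm : ∀ k, (m k).transpose = -m k) (hm' : ∀ k, (m' k).transpose = -m' k)
    (hDm : ∀ k, (m k).map D = (m k).map TrivSqZeroExt.inl)
    (h : ∀ t, D (coords (transport X X⁻¹ m) t) =
      TrivSqZeroExt.inl (coords (transport X X⁻¹ m) t) +
        TrivSqZeroExt.inr (coords (transport X X⁻¹ m') t)) :
    ∃ a : Matrix (Fin n) (Fin n) M, ∀ k, infTransport a m k = m' k := by
  obtain ⟨a, ha⟩ := map_dual_eq X hX D hD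
  have hXY := map_inl_mul_map_inl_inv X hX
  set Xi := X.map (TrivSqZeroExt.inl : M → DualNumber M)
  set Yi := X⁻¹.map (TrivSqZeroExt.inl : M → DualNumber M) with hYi
  have hDY : X⁻¹.map D = Yi * (1 + (-a).map (TrivSqZeroExt.inr : M → DualNumber M)) := by
    refine (map_inv_of_isUnit_det (D : M →+* DualNumber M) X hX).trans
      (Matrix.inv_eq_right_inv ?_)
    change X.map D * _ = 1
    rw [ha, Matrix.mul_assoc, ← Matrix.mul_assoc Xi, hXY, Matrix.one_mul, one_add_inr_mul]
  let U : Fin n → Matrix (Fin n) (Fin n) (DualNumber M) := fun k =>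
    (m k).map TrivSqZeroExt.inl + (infTransport a m k).map TrivSqZeroExt.inr
  let V : Fin n → Matrix (Fin n) (Fin n) (DualNumber M) := fun k =>
    (m k).map TrivSqZeroExt.inl + (m' k).map TrivSqZeroExt.inr
  -- Both sides are the image of the transported `m` under `D`: the left one by `D X = (1 + εa) X`,
  -- the right one by `h`.
  have hUV : transport Xi Yi U = transport Xi Yi V := by
    refine coords_injOn (K := K)
      (transport_transpose _ _ _ fun k => transpose_inl_add_inr _ _ (hm k)
        (infTransport_transpose _ _ hm k))
      (transport_transpose _ _ _ fun k => transpose_inl_add_inr _ _ (hm k) (hm' k)) ?_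
    funext t
    have h1 : coords (transport Xi Yi U) t = D (coords (transport X X⁻¹ m) t) := by
      have h2 : U = transport (1 + a.map (TrivSqZeroExt.inr : M → DualNumber M))
          (1 + (-a).map (TrivSqZeroExt.inr : M → DualNumber M))
          (fun l => (m l).map (TrivSqZeroExt.inl : M → DualNumber M)) :=
        funext fun k => (transport_dualNumber_infTransport a m k).symm
      rw [h2, transport_transport, ← ha, ← hDY]
      simp only [← hDm]
      exact (congrFun (congrFun (transport_map (D : M →+* DualNumber M) X X⁻¹ m t.1.2.2)
        t.1.1) t.1.2.1).symm
    have hV : V = (fun k => (m k).map (TrivSqZeroExt.inlHom M M)) +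
      fun k => (m' k).map TrivSqZeroExt.inr := rfl
    rw [h1, h, hV, map_add, map_add, Pi.add_apply]
    exact congrArg₂ _
      (congrFun (congrFun (transport_map (TrivSqZeroExt.inlHom M M) X X⁻¹ m t.1.2.2)
        t.1.1) t.1.2.1)
      (congrFun (congrFun (transport_inl_inr X X⁻¹ m' t.1.2.2) t.1.1) t.1.2.1).symm
  have hUV' := congrArg (transport Yi Xi) hUV
  rw [transport_transport, transport_transport, hXY, transport_one, transport_one] at hUV'
  refine ⟨a, fun k => ?_⟩
  ext i j
  have h8 := congrArg TrivSqZeroExt.snd (congrFun (congrFun (congrFun hUV' k) i) j)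
  simpa [U, V, -DualNumber.inr_eq_smul_eps] using h8

theorem tangentSpace_orbit_le_B2 [CharZero K] (μ : SBil K E) :
    tangentSpace b (orbit μ) μ ≤ B2 μ := by
  intro φ hφ
  let A := GLRing n K
  have hdom : IsDomain A := IsLocalization.isDomain_localization
    (Submonoid.powers_le.2 (mem_nonZeroDivisors_of_ne_zero (Matrix.det_mvPolynomialX_ne_zero _ _)))
  let M := FractionRing A
  have hess : Algebra.EssFiniteType K M := .comp K A M
  let ι : A →ₐ[K] M := IsScalarTower.toAlgHom K A M
  have hι : Function.Injective ι := IsFractionRing.injective A M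
  have htM : ∀ (ν : SBil K E) l, ((tensor b ν l).map (algebraMap K M)).transpose =
      -(tensor b ν l).map (algebraMap K M) := fun ν l => by
    rw [← Matrix.transpose_map, tensor_transpose]
    ext i j
    simp
  have hpt : ∀ (ν : SBil K E) t, ι (orbitPoint (tensor b ν) t) =
      coords (transport ((genericMatrix n K).map ι) ((genericMatrix n K).map ι)⁻¹
        fun l => (tensor b ν l).map (algebraMap K M)) t :=
    fun ν t => map_orbitPoint ι _ t
  let ev : MvPolynomial (Idx n) K →ₐ[K] M := aeval fun t => ι (orbitPoint (tensor b μ) t)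
  let F : MvPolynomial (Idx n) K →ₐ[K] DualNumber M := aeval fun t =>
    (TrivSqZeroExt.inl (ι (orbitPoint (tensor b μ) t)) +
      TrivSqZeroExt.inr (ι (orbitPoint (tensor b φ) t)) : DualNumber M)
  have hF : ∀ p, F p = TrivSqZeroExt.inl (ev p) + TrivSqZeroExt.inr
      (∑ t, ev (pderiv t p) * ι (orbitPoint (tensor b φ) t)) := fun p => aeval_dualNumber _ _ p
  have hev : ∀ p, ev p = ι (aeval (orbitPoint (tensor b μ)) p) := fun p => by
    rw [← AlgHom.comp_apply, comp_aeval]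
  -- Tangency at the generic point is exactly the condition that `F` kills the kernel of `ev`.
  obtain ⟨D, hD1, hD2⟩ := exists_dualNumber_extension ev F
    (fun p => by rw [hF]; simp [-DualNumber.inr_eq_smul_eps])
    (fun p hp => by
      rw [hev, map_eq_zero_iff ι hι] at hp
      have h0 := sum_aeval_orbitPoint_eq_zero b hφ ((mem_vanishingIdeal_orbit_iff b μ p).2 hp)
      rw [hF, hev, hp]
      simp only [hev, ← map_mul, ← map_sum]
      rw [h0]
      simp)
  obtain ⟨a, ha⟩ := exists_infTransport_eq ((genericMatrix n K).map ι)
    (isUnit_det_map_genericMatrix ι) D hD1 (fun l => (tensor b μ l).map (algebraMap K M))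
    (fun l => (tensor b φ l).map (algebraMap K M)) (htM μ) (htM φ)
    (fun k => by
      refine Matrix.ext fun i j => ?_
      exact D.commutes _)
    (fun t => by
      rw [← hpt, ← hpt]
      have h6 := hD2 (MvPolynomial.X t)
      simpa only [ev, F, aeval_X] using h6)
  exact mem_B2_of_infTransport_eq b a ha

theorem tangentSpace_orbit_eq_B2 [CharZero K] (μ : SBil K E) : tangentSpace b (orbit μ) μ = B2 μ :=
  le_antisymm (tangentSpace_orbit_le_B2 b μ) (B2_le_tangentSpace_orbit b μ)

end Orbits

/-! ### Linear algebra of projections and differentials -/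

section LinearAlgebra

variable {K : Type*} [Field K]

/-- Extend a section of `d` over its range to all of `W`; then `d ∘ α` is a projection onto the
range. -/
theorem exists_generalized_inverse {V W : Type*} [AddCommGroup V] [Module K V] [AddCommGroup W]
    [Module K W] (d : V →ₗ[K] W) : ∃ α : W →ₗ[K] V, ∀ v, d (α (d v)) = d v := by
  obtain ⟨s, hs⟩ := LinearMap.exists_rightInverse_of_surjective d.rangeRestrict
    d.range_rangeRestrict
  obtain ⟨α, hα⟩ := LinearMap.exists_extend s
  refine ⟨α, fun v => ?_⟩
  have h1 := LinearMap.congr_fun hα (d.rangeRestrict v)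
  have h2 := congrArg Subtype.val (LinearMap.congr_fun hs (d.rangeRestrict v))
  simp only [LinearMap.comp_apply] at h1 h2
  change α (d v) = _ at h1
  rw [h1]
  exact h2

/-- The differential at `x` of a polynomial, as a linear form. -/
noncomputable def polyDifferential {σ : Type*} [Fintype σ] (x : σ → K) :
    MvPolynomial σ K →ₗ[K] Module.Dual K (σ → K) where
  toFun p := ∑ s, eval x (pderiv s p) • LinearMap.proj s
  map_add' p q := by simp [add_smul, Finset.sum_add_distrib]
  map_smul' c p := by simp [Finset.smul_sum, smul_smul]

theorem polyDifferential_apply {σ : Type*} [Fintype σ] (x : σ → K) (p : MvPolynomial σ K)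
    (v : σ → K) : polyDifferential x p v = ∑ s, eval x (pderiv s p) * v s := by
  simp [polyDifferential, LinearMap.sum_apply]

/-- The differentials of members of `I` form a subspace of a finite-dimensional dual, so they are
all the forms vanishing on their common kernel. -/
theorem exists_mem_ideal_polyDifferential_eq {σ : Type*} [Fintype σ] (x : σ → K)
    (I : Ideal (MvPolynomial σ K)) (l : Module.Dual K (σ → K))
    (hl : ∀ v, (∀ p ∈ I, polyDifferential x p v = 0) → l v = 0) :
    ∃ p ∈ I, polyDifferential x p = l := by
  let D : Submodule K (Module.Dual K (σ → K)) :=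
    (I.restrictScalars K).map (polyDifferential x)
  have h : l ∈ D := by
    rw [← Subspace.dualCoannihilator_dualAnnihilator_eq (W := D)]
    rw [Submodule.mem_dualAnnihilator]
    intro v hv
    rw [Submodule.mem_dualCoannihilator] at hv
    exact hl v fun p hp => hv _ ⟨p, hp, rfl⟩
  obtain ⟨p, hp, rfl⟩ := h
  exact ⟨p, hp, rfl⟩

theorem le_of_le_of_finrank_eq {V : Type*} [AddCommGroup V] [Module K V] [FiniteDimensional K V]
    {S T : Submodule K V} (hle : S ≤ T) (h : Module.finrank K S = Module.finrank K T) : T ≤ S :=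
  (Submodule.eq_of_le_of_finrank_eq hle h).ge

end LinearAlgebra

/-! ### The slice transversal to the orbit -/

section Slice

variable {K : Type*} [Field K] {n : ℕ}

theorem transport_dualNumber_inr {R : Type*} [CommRing R] (a c : Matrix (Fin n) (Fin n) R)
    (m : Fin n → Matrix (Fin n) (Fin n) R) :
    transport (1 + a.map (TrivSqZeroExt.inr : R → DualNumber R))
        (1 + c.map (TrivSqZeroExt.inr : R → DualNumber R))
        (fun l => (m l).map (TrivSqZeroExt.inr : R → DualNumber R)) =
      fun l => (m l).map (TrivSqZeroExt.inr : R → DualNumber R) := by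
  have h : (fun l => (m l).map (TrivSqZeroExt.inr : R → DualNumber R)) =
      (DualNumber.eps : DualNumber R) • fun l => (m l).map TrivSqZeroExt.inl := by
    funext l
    ext i j <;> simp [-DualNumber.inr_eq_smul_eps]
  rw [h, map_smul]
  funext k
  rw [Pi.smul_apply, Pi.smul_apply, transport_dualNumber]
  ext i j <;> simp [-DualNumber.inr_eq_smul_eps]

variable (α : (Idx n → K) →ₗ[K] Matrix (Fin n) (Fin n) K) (γ : (Idx n → K) →ₗ[K] (Idx n → K))
  (m₀ : Idx n → K)

/-- The family of matrices `1 + α x`, with scalars in a `K`-algebra. -/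
noncomputable def moveMatrix {R : Type*} [CommRing R] [Algebra K R] (x : Idx n → R) :
    Matrix (Fin n) (Fin n) R :=
  1 + ∑ s, x s • (α (Pi.single s 1)).map (algebraMap K R)

/-- The affine slice `m₀ + γ x`, with scalars in a `K`-algebra. -/
noncomputable def slicePoint {R : Type*} [CommRing R] [Algebra K R] (x : Idx n → R) : Idx n → R :=
  fun t => algebraMap K R (m₀ t) + ∑ s, algebraMap K R (γ (Pi.single s 1) t) * x s

/-- The equations expressing that `1 + α x` transforms the point `m₀ + γ x` into `y`. -/
noncomputable def sliceRel {R : Type*} [CommRing R] [Algebra K R] (x y : Idx n → R) : Idx n → R :=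
  coords (transport (moveMatrix α x) 1 (skewTensor (slicePoint γ m₀ x))) -
    coords (transport 1 (moveMatrix α x) (skewTensor y))

theorem map_moveMatrix {R S : Type*} [CommRing R] [CommRing S] [Algebra K R] [Algebra K S]
    (f : R →+* S) (hf : ∀ c, f (algebraMap K R c) = algebraMap K S c) (x : Idx n → R) :
    (moveMatrix α x).map f = moveMatrix α fun s => f (x s) := by
  ext i j
  simp [moveMatrix, Matrix.sum_apply, hf, Matrix.one_apply, apply_ite f]

/-- Naturality lets one formula serve as a system of polynomials, as its values over `K`, and as its
first-order expansion over the dual numbers. -/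
theorem map_sliceRel {R S : Type*} [CommRing R] [CommRing S] [Algebra K R] [Algebra K S]
    (f : R →+* S) (hf : ∀ c, f (algebraMap K R c) = algebraMap K S c) (x y : Idx n → R)
    (t : Idx n) : f (sliceRel α γ m₀ x y t) =
      sliceRel α γ m₀ (fun s => f (x s)) (fun s => f (y s)) t := by
  have h1 : (fun s => f (slicePoint γ m₀ x s)) = slicePoint γ m₀ fun s => f (x s) := by
    funext s
    simp [slicePoint, hf]
  have h2 : ∀ (X Y : Matrix (Fin n) (Fin n) R) (v : Idx n → R),
      f (coords (transport X Y (skewTensor v)) t) =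
        coords (transport (X.map f) (Y.map f) (skewTensor fun s => f (v s))) t := by
    intro X Y v
    have h := congrFun (congrFun (transport_map f X Y (skewTensor v) t.1.2.2) t.1.1) t.1.2.1
    simp only [skewTensor_map] at h
    exact h
  rw [sliceRel, Pi.sub_apply, map_sub, h2, h2, map_moveMatrix α f hf, h1]
  simp [sliceRel]

theorem moveMatrix_inr (w : Idx n → K) :
    moveMatrix α (fun s => (TrivSqZeroExt.inr (w s) : DualNumber K)) =
      1 + (α w).map TrivSqZeroExt.inr := by
  have h : α w = ∑ s, w s • α (Pi.single s 1) := by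
    conv_lhs => rw [← Finset.univ_sum_single w]
    rw [map_sum]
    refine Finset.sum_congr rfl fun s _ => ?_
    rw [← map_smul, ← Pi.single_smul, smul_eq_mul, mul_one]
  rw [moveMatrix, h]
  congr 1
  ext i j
  · simp [Matrix.sum_apply, TrivSqZeroExt.fst_sum, TrivSqZeroExt.algebraMap_eq_inl,
      -DualNumber.inr_eq_smul_eps]
  · simp [Matrix.sum_apply, TrivSqZeroExt.snd_sum, TrivSqZeroExt.algebraMap_eq_inl,
      -DualNumber.inr_eq_smul_eps]

theorem slicePoint_inr (w : Idx n → K) :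
    slicePoint γ m₀ (fun s => (TrivSqZeroExt.inr (w s) : DualNumber K)) =
      (fun t => TrivSqZeroExt.inl (m₀ t)) + fun t => TrivSqZeroExt.inr (γ w t) := by
  funext t
  change _ = (TrivSqZeroExt.inl (m₀ t) + TrivSqZeroExt.inr (γ w t) : DualNumber K)
  rw [← linPullback_aux γ w t]
  ext
  · simp [slicePoint, TrivSqZeroExt.fst_sum, TrivSqZeroExt.algebraMap_eq_inl,
      -DualNumber.inr_eq_smul_eps]
  · simp [slicePoint, TrivSqZeroExt.snd_sum, TrivSqZeroExt.algebraMap_eq_inl,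
      -DualNumber.inr_eq_smul_eps]

theorem skewTensor_inr {R : Type*} [CommRing R] (v : Idx n → R) :
    skewTensor (fun t => (TrivSqZeroExt.inr (v t) : DualNumber R)) =
      fun k => (skewTensor v k).map TrivSqZeroExt.inr := by
  funext k
  refine Matrix.ext fun i j => ?_
  simp only [skewTensor, LinearMap.coe_mk, AddHom.coe_mk, Matrix.map_apply, Matrix.of_apply]
  split_ifs
  · rfl
  · exact (TrivSqZeroExt.inr_neg R _).symm
  · exact (TrivSqZeroExt.inr_zero R).symm

theorem skewTensor_inl {R : Type*} [CommRing R] (v : Idx n → R) :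
    skewTensor (fun t => (TrivSqZeroExt.inl (v t) : DualNumber R)) =
      fun k => (skewTensor v k).map TrivSqZeroExt.inl :=
  funext fun k => (skewTensor_map (TrivSqZeroExt.inlHom R R) v k).symm

/-- To first order at `x = 0`, `y = m₀`, the two matrix actions contribute the coboundary of `α w`
and the slice contributes `γ w`; by `hαγ` the sum is `w`, so the Jacobian matrix is the identity. -/
theorem sliceRel_dualNumber
    (hαγ : ∀ w, coords (infTransport (α w) (skewTensor m₀)) + γ w = w) (w : Idx n → K)
    (t : Idx n) :
    sliceRel α γ m₀ (fun s => (TrivSqZeroExt.inr (w s) : DualNumber K))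
      (fun s => TrivSqZeroExt.inl (m₀ s)) t = TrivSqZeroExt.inr (w t) := by
  have h0 : (1 : Matrix (Fin n) (Fin n) (DualNumber K)) =
      1 + (0 : Matrix (Fin n) (Fin n) K).map TrivSqZeroExt.inr := by
    ext i j <;> simp [-DualNumber.inr_eq_smul_eps]
  have h1 : w t = (infTransport (α w) (skewTensor m₀) t.1.2.2) t.1.1 t.1.2.1 + γ w t :=
    (congrFun (hαγ w) t).symm
  have h2 : (skewTensor (γ w) t.1.2.2) t.1.1 t.1.2.1 = γ w t :=
    congrFun (coords_skewTensor (γ w)) t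
  have hA := transport_dualNumber (α w) 0 (skewTensor m₀) t.1.2.2
  have hB := transport_dualNumber 0 (α w) (skewTensor m₀) t.1.2.2
  have hC := transport_dualNumber_inr (α w) 0 (skewTensor (γ w))
  rw [← h0] at hA hB hC
  rw [sliceRel, moveMatrix_inr, slicePoint_inr, map_add, map_add, skewTensor_inl, skewTensor_inr,
    hC, Pi.sub_apply, coords_apply, coords_apply, Pi.add_apply, hA, hB, h1, ← h2]
  ext <;> simp [infTransport, -DualNumber.inr_eq_smul_eps]
  ring

/-- Near `m₀`, every point is obtained from a point of the slice `m₀ + γ x` by a matrix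
`1 + α x`. -/
theorem exists_sliceRel_eq_zero [IsAlgClosed K]
    (hαγ : ∀ w, coords (infTransport (α w) (skewTensor m₀)) + γ w = w)
    (h : MvPolynomial (Idx n) K) (hh : eval 0 h ≠ 0) :
    ∃ g : MvPolynomial (Idx n) K, eval m₀ g ≠ 0 ∧ ∀ y, eval y g ≠ 0 →
      ∃ x : Idx n → K, (∀ t, sliceRel α γ m₀ x y t = 0) ∧ eval x h ≠ 0 := by
  let v : Idx n → MvPolynomial (Idx n) (MvPolynomial (Idx n) K) :=
    sliceRel α γ m₀ X (fun s => C (X s))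
  have hv : ∀ x y t, eval₂ (eval y) x (v t) = sliceRel α γ m₀ x y t := by
    intro x y t
    have := map_sliceRel α γ m₀ (eval₂Hom (eval y) x)
      (fun c => by simp [MvPolynomial.algebraMap_apply]) X (fun s => C (X s)) t
    simpa using this
  have hh' : ∀ x y : Idx n → K, eval₂ (eval y) x (map C h) = eval x h := by
    intro x y
    rw [eval₂_map]
    have : (eval y).comp C = RingHom.id K := by
      ext c
      simp
    rw [this, eval₂_id]
  have hd : ∀ (w : Idx n → K) (t : Idx n), (TrivSqZeroExt.inl (eval₂ (eval m₀) 0 (v t)) +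
      TrivSqZeroExt.inr (∑ s, eval₂ (eval m₀) 0 (pderiv s (v t)) * w s) : DualNumber K) =
      TrivSqZeroExt.inr (w t) := by
    intro w t
    rw [← eval₂_dualNumber, ← sliceRel_dualNumber α γ m₀ hαγ w t]
    have := map_sliceRel α γ m₀ (eval₂Hom ((TrivSqZeroExt.inlHom K K).comp (eval m₀))
      (fun s => (TrivSqZeroExt.inl ((0 : Idx n → K) s) + TrivSqZeroExt.inr (w s) : DualNumber K)))
      (fun c => by simp [MvPolynomial.algebraMap_apply, TrivSqZeroExt.algebraMap_eq_inl])
      X (fun s => C (X s)) t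
    simpa [-DualNumber.inr_eq_smul_eps] using this
  obtain ⟨g, hg1, hg2⟩ := exists_basicOpen_solution v (map C h) 0 m₀
    (fun t => by
      have := congrArg TrivSqZeroExt.fst (hd 0 t)
      simpa [-DualNumber.inr_eq_smul_eps] using this)
    (by
      have : (Matrix.of fun i j => eval₂ (eval m₀) 0 (pderiv i (v j))) =
          (1 : Matrix (Idx n) (Idx n) K) := by
        ext i j
        have := congrArg TrivSqZeroExt.snd (hd (Pi.single i 1) j)
        simpa [-DualNumber.inr_eq_smul_eps, Pi.single_apply, Matrix.one_apply, eq_comm] using this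
      rw [this, Matrix.det_one]
      exact one_ne_zero)
    (by rwa [hh'])
  refine ⟨g, hg1, fun y hy => ?_⟩
  obtain ⟨x, hx1, hx2⟩ := hg2 y hy
  exact ⟨x, fun t => by rw [← hv, hx1], by rwa [hh'] at hx2⟩

end Slice

/-! ### Rigidity -/

section Rigidity

variable {K : Type*} [Field K] {E : Type*} [AddCommGroup E] [Module K E] {n : ℕ}
  (b : Module.Basis (Fin n) K E)

/-- Each coordinate of `γ` vanishes on `B2 μ`, hence on the tangent space of `W`, hence is the
differential of an equation of `W`. -/
theorem exists_polynomials_of_tangentSpace_le {W : Set (SBil K E)} {μ : SBil K E}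
    (hT : tangentSpace b W μ ≤ B2 μ) (γ : (Idx n → K) →ₗ[K] (Idx n → K))
    (hγ : ∀ f, γ (structConst b (coboundary μ f)) = 0) (t : Idx n) :
    ∃ p ∈ vanishingIdeal K (structConst b '' W),
      ∀ s, eval (structConst b μ) (pderiv s p) = γ (Pi.single s 1) t := by
  obtain ⟨p, hp, hpl⟩ := exists_mem_ideal_polyDifferential_eq (structConst b μ)
    (vanishingIdeal K (structConst b '' W)) (LinearMap.proj t ∘ₗ γ) (fun v hv => by
      obtain ⟨φ, rfl⟩ := exists_structConst_eq b v
      obtain ⟨f, rfl⟩ := hT ((mem_tangentSpace_iff b).2 fun p hp => by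
        rw [← polyDifferential_apply, hv p hp])
      simp [hγ])
  refine ⟨p, hp, fun s => ?_⟩
  have := LinearMap.congr_fun hpl (Pi.single s 1)
  rw [polyDifferential_apply] at this
  simpa [Pi.single_apply] using this

/-- The slice equations avoid the inverse matrix in order to be polynomial; where the determinant is
nonzero, multiplying the values by the inverse recovers the action. -/
theorem exists_act_eq_of_sliceRel_eq_zero [CharZero K]
    (α : (Idx n → K) →ₗ[K] Matrix (Fin n) (Fin n) K)
    (γ : (Idx n → K) →ₗ[K] (Idx n → K)) (m₀ x : Idx n → K) (ω : SBil K E)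
    (hx : ∀ t, sliceRel α γ m₀ x (structConst b ω) t = 0) (hdet : (moveMatrix α x).det ≠ 0) :
    ∃ (f : E ≃ₗ[K] E) (ν : SBil K E), structConst b ν = m₀ + γ x ∧ act f ν = ω := by
  obtain ⟨ν, hν⟩ := exists_structConst_eq b (m₀ + γ x)
  have hF := isUnit_iff_ne_zero.2 hdet
  obtain ⟨f, hf⟩ := exists_equiv_of_isUnit_det b _ hF
  refine ⟨f, ν, hν, tensor_injective b ?_⟩
  have hs : slicePoint γ m₀ x = m₀ + γ x := by
    funext t
    rw [Pi.add_apply, ← linPullback_aux γ x t]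
    simp [slicePoint]
  have h1 : coords (transport (moveMatrix α x) 1 (tensor b ν)) =
      coords (transport 1 (moveMatrix α x) (tensor b ω)) := by
    rw [← sub_eq_zero, ← skewTensor_structConst, ← skewTensor_structConst, hν, ← hs]
    exact funext hx
  have h2 := congrArg (transport 1 (moveMatrix α x)⁻¹) (coords_injOn (K := K)
    (transport_transpose _ _ _ (tensor_transpose b ν))
    (transport_transpose _ _ _ (tensor_transpose b ω)) h1)
  rw [transport_transport, transport_transport, Matrix.mul_one, Matrix.mul_one, Matrix.mul_one,
    Matrix.nonsing_inv_mul _ hF, transport_one] at h2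
  rw [hf, h2]

theorem exists_basicOpen_inter_subset_orbit [CharZero K] [IsAlgClosed K] {W : Set (SBil K E)}
    (hW : IsStable W) {μ : SBil K E} (hμ : μ ∈ W) (hT : tangentSpace b W μ ≤ B2 μ) :
    ∃ g : MvPolynomial (Idx n) K, eval (structConst b μ) g ≠ 0 ∧
      ∀ ω ∈ W, eval (structConst b ω) g ≠ 0 → ω ∈ orbit μ := by
  let d : (E →ₗ[K] E) →ₗ[K] (Idx n → K) := structConst b ∘ₗ coboundary μ
  obtain ⟨α', hα'⟩ := exists_generalized_inverse d
  let α : (Idx n → K) →ₗ[K] Matrix (Fin n) (Fin n) K :=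
    (LinearMap.toMatrix b b).toLinearMap ∘ₗ α'
  -- The complementary projection, with kernel the image of `d`, that is, the coordinates of `B2 μ`.
  let γ : (Idx n → K) →ₗ[K] (Idx n → K) := LinearMap.id - d ∘ₗ α'
  have hγd : ∀ f, γ (structConst b (coboundary μ f)) = 0 := fun f => by
    change d f - d (α' (d f)) = 0
    rw [hα', sub_self]
  have hγγ : ∀ x, γ (γ x) = γ x := fun x => by
    change γ (x - d (α' x)) = γ x
    rw [map_sub]
    change γ x - γ (structConst b (coboundary μ (α' x))) = γ x
    rw [hγd, sub_zero]
  have hαγ : ∀ w, coords (infTransport (α w) (skewTensor (structConst b μ))) + γ w = w := by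
    intro w
    have h1 : coords (infTransport (α w) (skewTensor (structConst b μ))) = d (α' w) := by
      rw [skewTensor_structConst]
      change coords (infTransport (LinearMap.toMatrix b b (α' w)) (tensor b μ)) = _
      rw [← tensor_coboundary]
      rfl
    rw [h1]
    change d (α' w) + (w - d (α' w)) = w
    abel
  choose p hpW hp using exists_polynomials_of_tangentSpace_le b hT γ hγd
  choose q hq0 hq using fun t => exists_hadamard (p t) (structConst b μ)
  have hpz : ∀ t, ∀ ν ∈ W, eval (structConst b ν) (p t) = 0 := fun t ν hν =>
    (mem_vanishingIdeal_iff.1 (hpW t)) _ ⟨ν, hν, rfl⟩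
  -- On the slice the equations `p t = 0` read `q(γx) · γx = 0`. As `γ(γx) = γx`, this amounts to
  -- `N(x) · γx = 0` with `N = 1 - γ + q(γx)`, and `N(0) = 1` because `q(0) = γ`.
  let N : Matrix (Idx n) (Idx n) (MvPolynomial (Idx n) K) := 1 -
    Matrix.of fun t s => C (γ (Pi.single s 1) t) - linPullback γ (q t s)
  have hN : ∀ x, N.map (eval x) = 1 -
      Matrix.of fun t s => γ (Pi.single s 1) t - eval (γ x) (q t s) := by
    intro x
    ext t s
    simp [N, Matrix.one_apply, apply_ite, eval_linPullback]
  have hF : ∀ x, (moveMatrix α (X : Idx n → MvPolynomial (Idx n) K)).map (eval x) =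
      moveMatrix α x := by
    intro x
    rw [map_moveMatrix α (eval x) (fun c => by simp [MvPolynomial.algebraMap_eq])]
    simp
  have hdet : ∀ x, eval x ((moveMatrix α (X : Idx n → MvPolynomial (Idx n) K)).det * N.det) =
      (moveMatrix α x).det * (N.map (eval x)).det := by
    intro x
    rw [map_mul, RingHom.map_det, RingHom.map_det, ← hF]
    rfl
  -- The product of determinants is `1` at `x = 0`; its nonvanishing makes `1 + αx` invertible and
  -- forces `γx = 0`.
  obtain ⟨g, hg1, hg2⟩ := exists_sliceRel_eq_zero α γ (structConst b μ) hαγ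
    ((moveMatrix α X).det * N.det) (by
      have h1 : N.map (eval 0) = 1 := by
        rw [hN]
        ext t s
        have h2 := (hq0 t s).trans (hp t s)
        simp only [Matrix.sub_apply, Matrix.of_apply, map_zero, h2, sub_self, sub_zero]
      rw [hdet, h1]
      simp [moveMatrix])
  refine ⟨g, hg1, fun ω hω hgω => ?_⟩
  obtain ⟨x, hx1, hx2⟩ := hg2 _ hgω
  rw [hdet] at hx2
  obtain ⟨f, ν, hν, rfl⟩ := exists_act_eq_of_sliceRel_eq_zero b α γ _ x ω hx1
    (left_ne_zero_of_mul hx2)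
  have hνW : ν ∈ W := by
    rw [← act_symm_act f ν]
    exact hW _ hω f.symm
  have hker : (N.map (eval x)).mulVec (γ x) = 0 := by
    funext t
    have h1 := hq t (γ x)
    rw [← hν, hpz t ν hνW, hpz t μ hμ, zero_add] at h1
    have h2 := linPullback_aux γ (γ x) t
    rw [hγγ] at h2
    rw [hN, Matrix.sub_mulVec, Matrix.one_mulVec, Pi.sub_apply]
    simp only [Matrix.mulVec, dotProduct, Matrix.of_apply, sub_mul, Finset.sum_sub_distrib]
    rw [h2, Pi.zero_apply]
    simp only [mul_comm (eval (γ x) _)]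
    rw [← h1]
    simp
  have hγx : γ x = 0 := Matrix.eq_zero_of_mulVec_eq_zero (right_ne_zero_of_mul hx2) hker
  rw [hγx, add_zero] at hν
  exact ⟨f, by rw [structConst_injective b hν]⟩

theorem isRigidIn_of_tangentSpace_le [CharZero K] [IsAlgClosed K] {W : Set (SBil K E)}
    (hW : IsStable W) {μ : SBil K E} (hμ : μ ∈ W) (hT : tangentSpace b W μ ≤ B2 μ) :
    IsRigidIn b W μ := by
  obtain ⟨g, hg1, hg2⟩ := exists_basicOpen_inter_subset_orbit b hW hμ hT
  -- The union of all `GL`-translates of the basic open set of `g`; it contains the whole orbit and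
  -- meets `W` only there.
  refine ⟨hμ, {ν | ∃ f : E ≃ₗ[K] E, eval (structConst b (act f ν)) g ≠ 0}, ?_, ?_⟩
  · choose L hL using exists_linear_act b
    refine ⟨Set.range fun f => linPullback (L f) g, fun ν => ?_⟩
    simp [eval_linPullback, hL]
  · ext ν
    constructor
    · rintro ⟨f, rfl⟩
      refine ⟨hW μ hμ f, f.symm, ?_⟩
      rwa [act_symm_act]
    · rintro ⟨hν, f, hf⟩
      have := isStable_orbit μ _ (hg2 _ (hW ν hν f) hf) f.symm
      rwa [act_symm_act] at this

theorem tangentSpace_mono {S W : Set (SBil K E)} (h : S ⊆ W) (μ : SBil K E) :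
    tangentSpace b S μ ≤ tangentSpace b W μ := fun _ hφ p hp =>
  hφ p (vanishingIdeal_anti_mono (Set.image_mono h) hp)

theorem finiteDimensional_SBil [CharZero K] {n : ℕ} (b : Module.Basis (Fin n) K E) :
    FiniteDimensional K (SBil K E) :=
  Module.Finite.of_injective (structConst b) (structConst_injective b)

/-- The orbit lies in `W`, so `B2 μ`, its tangent space, is contained in that of `W`; equal finite
dimensions give equality. -/
theorem tangentSpace_le_B2_of_finrank_eq [CharZero K] {W : Set (SBil K E)} (hW : IsStable W)
    {μ : SBil K E} (hμ : μ ∈ W)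
    (h : Module.finrank K (B2 μ) = Module.finrank K (tangentSpace b W μ)) :
    tangentSpace b W μ ≤ B2 μ := by
  have hfin : FiniteDimensional K (SBil K E) := finiteDimensional_SBil b
  have hle : B2 μ ≤ tangentSpace b W μ := by
    rw [← tangentSpace_orbit_eq_B2 b μ]
    refine tangentSpace_mono b ?_ μ
    intro ν hν
    obtain ⟨f, hf⟩ := hν
    rw [← hf]
    exact hW μ hμ f
  have := @le_of_le_of_finrank_eq K _ (SBil K E) _ _ hfin _ _ hle
  exact this h

end Rigidity

end RigidMul

theorem mainTheorem8 {K : Type*} [Field K] [IsAlgClosed K] [CharZero K]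
    {E : Type*} [AddCommGroup E] [Module K E] {n : ℕ} (b : Module.Basis (Fin n) K E)
    (W : Set (RigidMul.SBil K E)) (hW : RigidMul.IsAlgebraicSubset b W)
    (hstable : RigidMul.IsStable W) (μ : RigidMul.SBil K E) (hμ : μ ∈ W) :
    RigidMul.tangentSpace b (RigidMul.orbit μ) μ = RigidMul.B2 μ ∧
      (Module.finrank K (RigidMul.B2 μ) = Module.finrank K (RigidMul.tangentSpace b W μ) →
        RigidMul.IsRigidIn b W μ) := by
  exact ⟨RigidMul.tangentSpace_orbit_eq_B2 b μ, fun hdim =>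
    RigidMul.isRigidIn_of_tangentSpace_le b hstable hμ
      (RigidMul.tangentSpace_le_B2_of_finrank_eq b hstable hμ hdim)⟩
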